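/- Let $\Lambda=\mathbb{C}[p_1,p_2,p_3,\dots]$ be the ring of symmetric functions in $x=(x_1,x_2,\dots)$, where $p_r=\sum_i x_i^r$, and let $P$ be the set of all partitions (of all integers $n\ge 0$). For $\rho\in P$ put $p_\rho=\prod_i p_{\rho_i}$ and $z_\rho=\prod_i i^{m_i(\rho)}\,m_i(\rho)!$, where $m_i(\rho)$ is the multiplicity of $i$ in $\rho$; let $\ell(\rho)$ be the number of parts. Let $\langle\,,\,\rangle_{-1}$ be the inner product on $\Lambda$ (linear in the first, conjugate-linear in the second argument) with $$\langle p_\rho,p_\sigma\rangle_{-1}=2^{-\ell(\rho)}z_\rho\,\delta_{\rho\sigma}.$$ For a partition $\nu$ of $n$ let $S_\nu=\sum_{\rho\vdash n}z_\rho^{-1}\chi^\nu_\rho\,p_\rho$ be the Schur function, where $\chi^\nu$ is the irreducible character of the symmetric group $\mathfrak{S}_n$ indexed by $\nu$, and let $S_\nu(x^2)$ be its image under $p_r\mapsto p_{2r}$ $(r\ge1)$. For a strict partition $\mu$ (all parts distinct) let $Q_\mu$ be Schur's $Q$-function: $q_n$ is defined by $\sum_{n\ge0}q_nu^n=\prod_i\frac{1+x_iu}{1-x_iu}$,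 one sets $Q_{(r,s)}=q_rq_s+2\sum_{i=1}^s(-1)^iq_{r+i}q_{s-i}$ for $r>s\ge0$, and, writing $\mu=(\mu_1>\mu_2>\dots>\mu_{2m}\ge0)$ with $2m\in\{\ell(\mu),\ell(\mu)+1\}$, $Q_\mu$ is the Pfaffian of the skew-symmetric $2m\times 2m$ matrix with entries $Q_{(\mu_i,\mu_j)}$ for $i<j$. Let $P_\mu=2^{-\ell(\mu)}Q_\mu$. For $\lambda\in P$ let $\lambda^r$ be the strict partition consisting of the parts of odd multiplicity in $\lambda$, each taken once, and let $\lambda^d$ be the partition with $m_i(\lambda^d)=\lfloor m_i(\lambda)/2\rfloor$ for all $i\ge1$. Put $$W_\lambda(x)=Q_{\lambda^r}(x)\,S_{\lambda^d}(x^2),\qquad V_\lambda(x)=P_{\lambda^r}(x)\,S_{\lambda^d}(x^2).$$ **Corollary 4.2.** The families $(W_\lambda)_{\lambda\in P}$ and $(V_\lambda)_{\lambda\in P}$ are bases of $\Lambda$, dual to each other with respect to $\langle\,,\,\rangle_{-1}$: for all $\lambda,\mu\in P$, $$\langle W_\lambda,V_\mu\rangle_{-1}=\delta_{\lambda\mu}.$$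 -/

import Mathlib

noncomputable section

namespace CompoundBasis

open MvPolynomial

/-! ### The ring of symmetric functions and its scalar product -/

/-- The ring of symmetric functions `Λ = ℂ[p₁, p₂, p₃, …]`, the polynomial ring in the power sums:
the variable `X r` is the `r`-th power sum `p_r(x)`, `r ≥ 1`. -/
abbrev SymFun : Type := MvPolynomial ℕ+ ℂ

/-- The set `P` of all partitions, of all integers `n ≥ 0`. -/
abbrev Ptn : Type := Σ n : ℕ, n.Partition

/-- The power sum product `p_ρ = ∏ p_{ρ_i}`; only used for multisets of positive integers. -/
def powerSum (ρ : Multiset ℕ) : SymFun := (ρ.map fun r => (X r.toPNat' : SymFun)).prod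

/-- `z_ρ = ∏_i i^{m_i} m_i!`, where `m_i` is the multiplicity of `i` in `ρ`. -/
def zee (ρ : Multiset ℕ) : ℕ := ρ.prod * ∏ i ∈ ρ.toFinset, (ρ.count i).factorial

/-- The partition `ρ` with `p_ρ` equal to the monomial with exponent `m`: the part `i` occurs
`m i` times. -/
def expParts (m : ℕ+ →₀ ℕ) : Multiset ℕ := (Finsupp.toMultiset m).map fun i => (i : ℕ)

/-- The inner product `⟨ , ⟩₋₁` on `Λ`: the form, linear in the first and conjugate-linear in the
second argument, with `⟨p_ρ, p_σ⟩ = 2^{-ℓ(ρ)} z_ρ δ_{ρσ}`. -/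
def innerNegOne (F G : SymFun) : ℂ :=
  ∑ m ∈ F.support, F.coeff m * (starRingEnd ℂ) (G.coeff m) *
    ((zee (expParts m) : ℂ) / 2 ^ Multiset.card (expParts m))

/-- The substitution `f(x) ↦ f(x²)`, `x² = (x₁², x₂², …)`, that is, `p_r ↦ p_{2r}`. -/
def sqVars : SymFun →ₐ[ℂ] SymFun := rename fun r : ℕ+ => 2 * r

/-! ### Irreducible characters of the symmetric group and Schur functions -/

/-- The cell (row, column), both counted from `0`, that contains the entry `k` in the tableau whose
row lengths are given by the list and whose rows are filled successively with `0, 1, 2, …`. -/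
def cell : List ℕ → ℕ → ℕ × ℕ
  | [], k => (0, k)
  | a :: l, k => if k < a then (0, k) else ((cell l (k - a)).1 + 1, (cell l (k - a)).2)

/-- The cell containing the entry `k` in the row-by-row filling of the Young diagram of `lam`. -/
def tableau {n : ℕ} (lam : n.Partition) (k : Fin n) : ℕ × ℕ := cell (lam.parts.sort (· ≥ ·)) k

open Classical in
/-- The row symmetrizer: the sum of all permutations preserving each row of the tableau. -/
def rowSum {n : ℕ} (lam : n.Partition) : MonoidAlgebra ℂ (Equiv.Perm (Fin n)) :=
  ∑ σ : Equiv.Perm (Fin n) with ∀ k, (tableau lam (σ k)).1 = (tableau lam k).1,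
    MonoidAlgebra.of ℂ _ σ

open Classical in
/-- The column antisymmetrizer: the signed sum of all permutations preserving each column. -/
def colSum {n : ℕ} (lam : n.Partition) : MonoidAlgebra ℂ (Equiv.Perm (Fin n)) :=
  ∑ σ : Equiv.Perm (Fin n) with ∀ k, (tableau lam (σ k)).2 = (tableau lam k).2,
    ((Equiv.Perm.sign σ : ℤ) : ℂ) • MonoidAlgebra.of ℂ _ σ

/-- The Specht module indexed by `lam`: the left ideal of `ℂ[𝔖ₙ]` generated by the Young
symmetrizer. -/
abbrev specht {n : ℕ} (lam : n.Partition) : Ideal (MonoidAlgebra ℂ (Equiv.Perm (Fin n))) :=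
  Ideal.span {rowSum lam * colSum lam}

/-- The irreducible character `χ^lam` of `𝔖ₙ`. -/
def chi {n : ℕ} (lam : n.Partition) (σ : Equiv.Perm (Fin n)) : ℂ :=
  (Representation.ofModule' (k := ℂ) (G := Equiv.Perm (Fin n)) (specht lam)).character σ

/-- The Schur function `S_lam = ∑_ρ z_ρ⁻¹ χ^lam_ρ p_ρ`, written as a sum over the elements of `𝔖ₙ`
(the class of cycle type `ρ`, fixed points included, has `n! / z_ρ` elements). -/
def schurS (lam : Ptn) : SymFun :=
  ((lam.1.factorial : ℂ))⁻¹ •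
    ∑ σ : Equiv.Perm (Fin lam.1), chi lam.2 σ • powerSum σ.partition.parts

/-! ### Schur's `Q`-functions and `P`-functions -/

/-- `q_n`, the coefficient of `u^n` in `∏_i (1 + x_i u) / (1 - x_i u) = exp (2 ∑_{k odd} p_k u^k / k)`,
namely the sum of `2^{ℓ(ρ)} z_ρ⁻¹ p_ρ` over all partitions `ρ` of `n` into odd parts. -/
def q (n : ℕ) : SymFun :=
  ∑ ρ ∈ Nat.Partition.odds n, ((2 : ℂ) ^ Multiset.card ρ.parts / (zee ρ.parts : ℂ)) •
    powerSum ρ.parts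

/-- `Q_{(r,s)} = q_r q_s + 2 ∑_{i=1}^s (-1)^i q_{r+i} q_{s-i}`, used for `r > s ≥ 0`. -/
def qPair (r s : ℕ) : SymFun :=
  q r * q s + 2 * ∑ i ∈ Finset.Icc 1 s, (-1) ^ i * (q (r + i) * q (s - i))

/-- The Pfaffian of a skew-symmetric matrix, by expansion along the first row. -/
def pfaffian {R : Type*} [CommRing R] : (n : ℕ) → Matrix (Fin n) (Fin n) R → R
  | 0, _ => 1
  | 1, _ => 0
  | n + 2, A => ∑ j : Fin (n + 1), (-1) ^ (j : ℕ) * A 0 j.succ *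
      pfaffian n (A.submatrix (fun i => (j.succAbove i).succ) (fun i => (j.succAbove i).succ))

/-- For a decreasing list `l`, the skew-symmetric matrix with entries `Q_{(l_i, l_j)}` for `i < j`,
where `l_i = 0` beyond the end of the list. -/
def qMatrix (l : List ℕ) (k : ℕ) : Matrix (Fin k) (Fin k) SymFun := fun i j =>
  if i < j then qPair (l.getD i 0) (l.getD j 0)
  else if j < i then -qPair (l.getD j 0) (l.getD i 0) else 0

/-- Schur's `Q`-function `Q_lam` of a strict partition `lam`: the Pfaffian of `(Q_{(lam_i, lam_j)})`
of size `ℓ(lam)` or `ℓ(lam) + 1`, whichever is even. -/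
def schurQ (lam : Ptn) : SymFun :=
  pfaffian (2 * ((Multiset.card lam.2.parts + 1) / 2))
    (qMatrix (lam.2.parts.sort (· ≥ ·)) (2 * ((Multiset.card lam.2.parts + 1) / 2)))

/-- Schur's `P`-function `P_lam = 2^{-ℓ(lam)} Q_lam` of a strict partition `lam`. -/
def schurP (lam : Ptn) : SymFun := ((2 : ℂ) ^ Multiset.card lam.2.parts)⁻¹ • schurQ lam

/-! ### The compound bases -/

/-- The strict partition `lam^r`: the parts of odd multiplicity in `lam`, each taken once. -/
def rPart (lam : Ptn) : Ptn :=
  ⟨_, Nat.Partition.ofMultiset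
    (lam.2.parts.toFinset.filter fun i => Odd (lam.2.parts.count i)).val⟩

/-- The partition `lam^d`, in which `i` has multiplicity `⌊m_i(lam) / 2⌋`. -/
def dPart (lam : Ptn) : Ptn :=
  ⟨_, Nat.Partition.ofMultiset
    (∑ i ∈ lam.2.parts.toFinset, Multiset.replicate (lam.2.parts.count i / 2) i)⟩

/-- `W_lam(x) = Q_{lam^r}(x) S_{lam^d}(x²)`. -/
def W (lam : Ptn) : SymFun := schurQ (rPart lam) * sqVars (schurS (dPart lam))

/-- `V_lam(x) = P_{lam^r}(x) S_{lam^d}(x²)`. -/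
def V (lam : Ptn) : SymFun := schurP (rPart lam) * sqVars (schurS (dPart lam))

end CompoundBasis

end

/-! The pairing splits into a factor on the odd power sums, where the `Q`-functions live, and a
factor on the even ones, where the `S(x²)` live.

Odd part. The adjoints of the multiplications by the `q n` are the coefficients of one algebra
homomorphism `shift`, which adds `v^k` to `p_k` for odd `k` (`bil_q_mul`). It multiplies the series
`q(u)` by `(1 + uv)/(1 - uv)`, and it changes the kernel `Q_{(r,s)}` by the rank two term `D(q_r)
q_s - q_r D(q_s)`, where `D` is `shift` (`shift_qKernel`). A Pfaffian changes in a simple way under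
a rank two change of kernel, which gives `D(Q_l) = Pf(l) + ∑ ± D(q_{l_j}) Q_{l∖j}`. As `D(q_n)` has
degree at most `n` in `v`, with top coefficient `2` for `n ≥ 1`, the adjoint of `q_n` kills `Q_l`
when `n` exceeds all parts and strips a largest part `n` with factor `2`. Conversely, modulo
multiples of `q_n` with `n > m`, the function `Q_{(m,l)}` is `q_m Q_l`. Induction on the length
gives `⟨Q_l h, Q_l' g⟩ = δ 2^{ℓ} ⟨h, g⟩` for all `h`, `g` fixed by `shift`, in particular for
functions of `x²` (`bil_schurQList_mul`).

Even part. The norm of `p_{2ρ}` is `z_ρ`, because the `ℓ(ρ)` doublings of parts cancel `2^{-ℓ(ρ)}`.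
So orthonormality of the `S_ν(x²)` is the orthogonality of the characters `χ^ν` (`sum_chi_mul_chi`),
which is derived from the Young symmetrizers through a trace formula for the left ideals they
generate.

Since `(λ^r, λ^d)` determines `λ`, the two families are dual for the bilinear form, and all
coefficients are real, so conjugation plays no role. Dual families are independent. Each `W_λ` and
`V_λ` is homogeneous of degree `|λ|`, and counting partitions in each degree shows that they span.
-/

noncomputable section

namespace CompoundBasis

/-! ### Pfaffians as linear forms on the exterior algebra -/

section Pfaffian

open CliffordAlgebra

variable {R : Type*} [CommRing R] {M : Type*} [AddCommGroup M] [Module R M]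

/-- The linear form on the exterior algebra that sends `v₁ ∧ ⋯ ∧ vₙ` to the Pfaffian of
`(B vᵢ vⱼ)`. -/
def pfForm (B : LinearMap.BilinForm R M) (hB : B.IsAlt) : ExteriorAlgebra R M →ₗ[R] R :=
  ExteriorAlgebra.algebraMapInv.toLinearMap ∘ₗ
    changeForm (Q := (0 : QuadraticForm R M)) (Q' := 0) (B := -B)
      (by ext v; simp [hB.self_eq_zero v])

theorem pfForm_one (B : LinearMap.BilinForm R M) (hB : B.IsAlt) : pfForm B hB 1 = 1 := by
  simp [pfForm]

/-- This is expansion along the first row. `changeForm` turns multiplication by `v` into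
multiplication by `v` plus contraction with `B v`, and the first of these has no scalar part. -/
theorem pfForm_ι_mul (B : LinearMap.BilinForm R M) (hB : B.IsAlt) (v : M)
    (x : ExteriorAlgebra R M) :
    pfForm B hB (ExteriorAlgebra.ι R v * x) = pfForm B hB (contractLeft (B v) x) := by
  have h : ExteriorAlgebra.algebraMapInv (R := R) (ExteriorAlgebra.ι R v) = 0 := by
    simp [ExteriorAlgebra.algebraMapInv]
  simp only [pfForm, LinearMap.comp_apply]
  rw [changeForm_contractLeft, ExteriorAlgebra.ι, changeForm_ι_mul]
  simp only [AlgHom.toLinearMap_apply, map_sub, map_mul]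
  rw [← ExteriorAlgebra.ι, h]
  simp

/-- The form `(v, w) ↦ f v * g w - g v * f w`. -/
def wedgeForm (f g : Module.Dual R M) : LinearMap.BilinForm R M :=
  LinearMap.BilinForm.linMulLin f g - LinearMap.BilinForm.linMulLin g f

theorem wedgeForm_apply (f g : Module.Dual R M) (v w : M) :
    wedgeForm f g v w = f v * g w - g v * f w := by
  simp [wedgeForm]

theorem wedgeForm_isAlt (f g : Module.Dual R M) : (wedgeForm f g).IsAlt := fun v => by
  rw [wedgeForm_apply]; ring

/-- The change of form is the exponential of a contraction with a decomposable two-form. It stops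
after the linear term, because contracting twice with `f` or twice with `g` gives zero. -/
theorem changeForm_neg_wedgeForm (f g : Module.Dual R M)
    (h : (-wedgeForm f g).toQuadraticMap = (0 : QuadraticForm R M) - 0)
    (x : CliffordAlgebra (0 : QuadraticForm R M)) :
    changeForm h x = x + contractLeft g (contractLeft f x) := by
  have key : ∀ v, (-wedgeForm f g) v = -(f v • g - g v • f) := by
    intro v; ext w; simp [wedgeForm_apply]
  induction x using CliffordAlgebra.left_induction with
  | algebraMap r => rw [changeForm_algebraMap, contractLeft_algebraMap, map_zero, add_zero]
  | add x y hx hy => simp only [map_add, hx, hy]; abel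
  | ι_mul x v hx =>
    rw [changeForm_ι_mul, hx, contractLeft_ι_mul, map_sub, map_smul, contractLeft_ι_mul, key]
    simp only [map_neg, map_sub, map_smul, LinearMap.neg_apply, LinearMap.sub_apply,
      LinearMap.smul_apply, map_add, contractLeft_contractLeft]
    rw [contractLeft_comm (d := f) (d' := g), contractLeft_contractLeft, map_zero, mul_add]
    simp only [smul_zero, neg_zero]
    abel

/-- Successive changes of form add up, so a rank two summand can be split off and evaluated by
`changeForm_neg_wedgeForm`. This is the source of the behaviour of `Q`-functions under `shift`. -/
theorem pfForm_add_wedgeForm (B : LinearMap.BilinForm R M) (hB : B.IsAlt) (f g : Module.Dual R M)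
    (hB' : (B + wedgeForm f g).IsAlt) (x : ExteriorAlgebra R M) :
    pfForm (B + wedgeForm f g) hB' x =
      pfForm B hB x + pfForm B hB (contractLeft g (contractLeft f x)) := by
  have h1 : (-wedgeForm f g).toQuadraticMap = (0 : QuadraticForm R M) - 0 := by
    ext v; simp [(wedgeForm_isAlt f g).self_eq_zero v]
  have h2 : (-B).toQuadraticMap = (0 : QuadraticForm R M) - 0 := by
    ext v; simp [hB.self_eq_zero v]
  rw [← map_add, ← changeForm_neg_wedgeForm f g h1]
  simp only [pfForm, LinearMap.comp_apply]
  rw [changeForm_changeForm]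
  have h : ∀ (b c : LinearMap.BilinForm R M)
      (hb : b.toQuadraticMap = (0 : QuadraticForm R M) - 0)
      (hc : c.toQuadraticMap = (0 : QuadraticForm R M) - 0), b = c →
      changeForm hb x = changeForm hc x := by
    rintro b c hb hc rfl; rfl
  exact congrArg _ (h _ _ _ _ (by abel))

/-! ### Pfaffians of a skew-symmetric kernel -/

variable {ι : Type*}

/-- The bilinear form on the free module with values `a i j` on the basis. -/
def kernelForm (a : ι → ι → R) : LinearMap.BilinForm R (ι →₀ R) :=
  Finsupp.linearCombination R fun i => Finsupp.linearCombination R (a i)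

theorem kernelForm_single (a : ι → ι → R) (i j : ι) :
    kernelForm a (Finsupp.single i 1) (Finsupp.single j 1) = a i j := by
  simp [kernelForm]

theorem kernelForm_single_left (a : ι → ι → R) (i : ι) :
    kernelForm a (Finsupp.single i 1) = Finsupp.linearCombination R (a i) := by
  simp [kernelForm]

theorem kernelForm_isAlt (a : ι → ι → R) (h0 : ∀ i, a i i = 0) (h1 : ∀ i j, a i j = -a j i) :
    (kernelForm a).IsAlt := by
  have hs : ∀ v w, kernelForm a v w = -kernelForm a w v := by
    intro v w
    have : kernelForm a = -(kernelForm a).flip := by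
      refine Finsupp.lhom_ext' fun i => LinearMap.ext_ring (Finsupp.lhom_ext' fun j =>
        LinearMap.ext_ring ?_)
      simp [kernelForm_single, h1 i j]
    exact congrArg (fun b => b v w) this
  intro v
  induction v using Finsupp.induction_linear with
  | zero => simp
  | add v w hv hw => simp [hv, hw, hs v w]
  | single i c =>
    have : Finsupp.single i c = c • Finsupp.single i (1 : R) := by simp
    rw [this]
    simp [kernelForm_single, h0, -Finsupp.smul_single]

/-- The exterior product of the basis vectors indexed by the entries of a list. -/
def wedge (R : Type*) [CommRing R] (l : List ι) : ExteriorAlgebra R (ι →₀ R) :=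
  (l.map fun i => ExteriorAlgebra.ι R (Finsupp.single i (1 : R))).prod

theorem wedge_nil : wedge R ([] : List ι) = 1 := rfl

theorem wedge_cons (i : ι) (l : List ι) :
    wedge R (i :: l) = ExteriorAlgebra.ι R (Finsupp.single i (1 : R)) * wedge R l := by
  simp [wedge]

theorem contractLeft_wedge_cons (d : Module.Dual R (ι →₀ R)) (i : ι) (l : List ι) :
    contractLeft d (wedge R (i :: l)) = d (Finsupp.single i 1) • wedge R l -
      ExteriorAlgebra.ι R (Finsupp.single i (1 : R)) * contractLeft d (wedge R l) := by
  rw [wedge_cons, ExteriorAlgebra.ι, contractLeft_ι_mul]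

theorem contractLeft_wedge (d : Module.Dual R (ι →₀ R)) (l : List ι) :
    contractLeft d (wedge R l) = ∑ j : Fin l.length,
      ((-1) ^ (j : ℕ) * d (Finsupp.single l[j] 1)) • wedge R (l.eraseIdx j) := by
  induction l with
  | nil => simp [wedge_nil]
  | cons i l ih =>
    rw [contractLeft_wedge_cons, ih]
    simp only [List.length_cons]
    rw [Fin.sum_univ_succ]
    simp [Finset.mul_sum, wedge_cons, pow_succ, sub_eq_add_neg, ← Finset.sum_neg_distrib]

theorem pfForm_wedge_cons (a : ι → ι → R) (hB : (kernelForm a).IsAlt) (i : ι) (l : List ι) :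
    pfForm _ hB (wedge R (i :: l)) = ∑ j : Fin l.length,
      ((-1) ^ (j : ℕ) * a i l[j]) * pfForm _ hB (wedge R (l.eraseIdx j)) := by
  rw [wedge_cons, pfForm_ι_mul, contractLeft_wedge, map_sum]
  simp [kernelForm_single]

theorem pfaffian_succ_succ (n : ℕ) (A : Matrix (Fin (n + 2)) (Fin (n + 2)) R) :
    pfaffian (n + 2) A = ∑ j : Fin (n + 1), (-1) ^ (j : ℕ) * A 0 j.succ *
      pfaffian n (A.submatrix (fun i => (j.succAbove i).succ) (fun i => (j.succAbove i).succ)) :=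
  rfl

/-- The matrix of the values of a kernel on the entries of a list. -/
def kernelMatrix (a : ℕ → ℕ → R) (l : List ℕ) (n : ℕ) : Matrix (Fin n) (Fin n) R :=
  Matrix.of fun i j => a (l.getD i 0) (l.getD j 0)

/-- Both sides satisfy the same first-row recursion; deleting row and column `j + 1` of the matrix
is erasing entry `j` of the tail. -/
theorem pfaffian_kernelMatrix (a : ℕ → ℕ → R) (hB : (kernelForm a).IsAlt) (n : ℕ) (l : List ℕ)
    (hl : l.length = n) :
    pfaffian n (kernelMatrix a l n) = pfForm _ hB (wedge R l) := by
  induction n using Nat.strong_induction_on generalizing l with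
  | _ n ih =>
  match n, l, hl with
  | 0, [], _ => simp [pfaffian, wedge_nil, pfForm_one]
  | 1, [i], _ => rw [pfForm_wedge_cons]; simp [pfaffian]
  | n + 2, i :: l, hl =>
    have hl' : l.length = n + 1 := by simpa using hl
    rw [pfForm_wedge_cons, pfaffian_succ_succ, ← (finCongr hl').sum_comp]
    refine Finset.sum_congr rfl fun j _ => ?_
    rw [← ih n (by omega) (l.eraseIdx j) (by simp [List.length_eraseIdx, hl']; omega)]
    congr 1
    · simp [kernelMatrix]
    · congr 1
      have : ∀ i' : Fin n, (i :: l).getD (((finCongr hl' j).succAbove i').succ : ℕ) 0 =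
          (l.eraseIdx j).getD i' 0 := by
        intro i'
        simp only [Fin.val_succ, List.getD_cons_succ]
        simp only [List.getD_eq_getElem?_getD, List.getElem?_eraseIdx, Fin.succAbove, Fin.lt_def]
        split_ifs <;> simp_all
      ext i' j'
      simp only [Matrix.submatrix_apply, kernelMatrix, Matrix.of_apply, this]

theorem pfForm_wedge_odd (a : ℕ → ℕ → R) (hB : (kernelForm a).IsAlt) (l : List ℕ)
    (hl : Odd l.length) : pfForm _ hB (wedge R l) = 0 := by
  obtain ⟨n, hn⟩ : ∃ n, l.length = n := ⟨_, rfl⟩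
  induction n using Nat.strong_induction_on generalizing l with
  | _ n ih =>
  match l with
  | [] => simp at hl
  | i :: l =>
    rw [pfForm_wedge_cons]
    refine Finset.sum_eq_zero fun j _ => ?_
    have h1 := j.2
    rw [ih (l.length - 1) (by simp at hn; omega) _ _ (by simp [List.length_eraseIdx]), mul_zero]
    simp [List.length_eraseIdx] at hl ⊢
    rw [Nat.odd_sub (by omega)]; grind

theorem pfaffian_map {S : Type*} [CommRing S] (D : R →+* S) (n : ℕ) (A : Matrix (Fin n) (Fin n) R) :
    D (pfaffian n A) = pfaffian n (A.map D) := by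
  induction n using Nat.strong_induction_on with
  | _ n ih =>
  match n with
  | 0 => simp [pfaffian]
  | 1 => simp [pfaffian]
  | n + 2 =>
    rw [pfaffian_succ_succ, pfaffian_succ_succ, map_sum]
    refine Finset.sum_congr rfl fun j _ => ?_
    rw [map_mul, ih n (by omega)]
    simp [Matrix.submatrix_map]

/-! ### Pfaffians along lists, with or without a bordering index -/

theorem wedge_append_singleton (l : List ι) (i : ι) :
    wedge R (l ++ [i]) = (-1 : R) ^ l.length • wedge R (i :: l) := by
  induction l with
  | nil => simp
  | cons j l ih =>
    rw [List.cons_append, wedge_cons, ih, wedge_cons, wedge_cons i (j :: l), wedge_cons j l,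
      List.length_cons, pow_succ, mul_smul_comm, ← mul_assoc, ← mul_assoc]
    have h := ExteriorAlgebra.ι_add_mul_swap (R := R) (Finsupp.single i (1 : R))
      (Finsupp.single j (1 : R))
    rw [eq_neg_of_add_eq_zero_left h]
    simp

/-- The Pfaffian of a kernel along a list of indices. -/
def pf (a : ℕ → ℕ → R) (l : List ℕ) : R := pfaffian l.length (kernelMatrix a l l.length)

/-- The Pfaffian along a list, together with its expansion along an additional last index `∞`,
where the kernel has the values `a i ∞ = q i`. -/
def pfSum (a : ℕ → ℕ → R) (q : ℕ → R) (l : List ℕ) : R :=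
  pf a l + ∑ j : Fin l.length, (-1) ^ (j : ℕ) * q l[j] * pf a (l.eraseIdx j)

theorem pf_nil (a : ℕ → ℕ → R) : pf a [] = 1 := rfl

theorem pfSum_nil (a : ℕ → ℕ → R) (q : ℕ → R) : pfSum a q [] = 1 := by simp [pfSum, pf_nil]

theorem map_pf {S : Type*} [CommRing S] (D : R →+* S) (a : ℕ → ℕ → R) (l : List ℕ) :
    D (pf a l) = pf (fun i j => D (a i j)) l := by
  rw [pf, pfaffian_map]; rfl

theorem map_pfSum {S : Type*} [CommRing S] (D : R →+* S) (a : ℕ → ℕ → R) (q : ℕ → R)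
    (l : List ℕ) :
    D (pfSum a q l) = pfSum (fun i j => D (a i j)) (fun i => D (q i)) l := by
  simp [pfSum, map_pf]

variable {a : ℕ → ℕ → R} (h0 : ∀ i, a i i = 0) (h1 : ∀ i j, a i j = -a j i)

include h0 h1

theorem pf_eq_pfForm (l : List ℕ) : pf a l = pfForm _ (kernelForm_isAlt a h0 h1) (wedge R l) :=
  pfaffian_kernelMatrix _ _ _ _ rfl

theorem pf_cons (i : ℕ) (l : List ℕ) :
    pf a (i :: l) = ∑ j : Fin l.length, (-1) ^ (j : ℕ) * a i l[j] * pf a (l.eraseIdx j) := by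
  simp only [pf_eq_pfForm h0 h1, pfForm_wedge_cons]

theorem pf_odd (l : List ℕ) (hl : Odd l.length) : pf a l = 0 := by
  rw [pf_eq_pfForm h0 h1, pfForm_wedge_odd _ _ _ hl]

theorem pf_append_singleton (l : List ℕ) (i : ℕ) :
    pf a (l ++ [i]) = (-1 : R) ^ l.length * pf a (i :: l) := by
  rw [pf_eq_pfForm h0 h1, wedge_append_singleton, map_smul, ← pf_eq_pfForm h0 h1, smul_eq_mul]

theorem pfForm_contractLeft_wedge (q : ℕ → R) (l : List ℕ) :
    pfForm _ (kernelForm_isAlt a h0 h1)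
      (contractLeft (Finsupp.linearCombination R q) (wedge R l)) =
    ∑ j : Fin l.length, (-1) ^ (j : ℕ) * q l[j] * pf a (l.eraseIdx j) := by
  rw [contractLeft_wedge, map_sum]
  simp [pf_eq_pfForm h0 h1]

theorem pfSum_eq_pfForm (q : ℕ → R) (l : List ℕ) :
    pfSum a q l = pfForm _ (kernelForm_isAlt a h0 h1)
      (wedge R l + contractLeft (Finsupp.linearCombination R q) (wedge R l)) := by
  rw [map_add, pfForm_contractLeft_wedge h0 h1, ← pf_eq_pfForm h0 h1]; rfl

theorem sum_mul_pfSum_eraseIdx (q f : ℕ → R) (l : List ℕ) :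
    ∑ j : Fin l.length, (-1) ^ (j : ℕ) * f l[j] * pfSum a q (l.eraseIdx j) =
    pfForm _ (kernelForm_isAlt a h0 h1)
      (contractLeft (Finsupp.linearCombination R f) (wedge R l) +
        contractLeft (Finsupp.linearCombination R q)
          (contractLeft (Finsupp.linearCombination R f) (wedge R l))) := by
  simp only [pfSum_eq_pfForm h0 h1]
  rw [contractLeft_wedge, map_sum, ← Finset.sum_add_distrib, map_sum]
  refine Finset.sum_congr rfl fun j _ => ?_
  rw [map_smul, ← smul_add, map_smul]
  simp

/-- Contracting twice with `q` gives zero, so the border terms of the shorter lists cancel and `pf`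
may be replaced by `pfSum` inside the sum. -/
theorem pfSum_eq_sum (q : ℕ → R) (l : List ℕ) :
    pfSum a q l =
      pf a l + ∑ j : Fin l.length, (-1) ^ (j : ℕ) * q l[j] * pfSum a q (l.eraseIdx j) := by
  rw [sum_mul_pfSum_eraseIdx h0 h1, contractLeft_contractLeft, add_zero,
    pfForm_contractLeft_wedge h0 h1]; rfl

/-- This is first-row expansion of the bordered Pfaffian; it rests on the anticommutation of the
contractions with `q` and with the row `a m`. -/
theorem pfSum_cons (q : ℕ → R) (m : ℕ) (l : List ℕ) :
    pfSum a q (m :: l) = q m * pf a l +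
      ∑ j : Fin l.length, (-1) ^ (j : ℕ) * a m l[j] * pfSum a q (l.eraseIdx j) := by
  rw [pfSum_eq_pfForm h0 h1, sum_mul_pfSum_eraseIdx h0 h1, contractLeft_wedge_cons, wedge_cons]
  simp only [map_add, map_sub, map_smul, pfForm_ι_mul, kernelForm_single_left,
    ← pf_eq_pfForm h0 h1]
  rw [contractLeft_comm (d := Finsupp.linearCombination R (a m)), map_neg]
  simp
  ring

/-- Write `w` for the wedge of the list. The rank two change adds the Pfaffian of `q ⌟ (f ⌟ x)` to
that of `x`. For `x = w + f ⌟ w` the repeated contraction with `f` dies, which leaves `w + f ⌟ w + q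
⌟ (f ⌟ w)`. -/
theorem pfSum_shift (q f : ℕ → R) (l : List ℕ) :
    pfSum (fun i j => a i j + (f i * q j - q i * f j)) f l =
      pf a l + ∑ j : Fin l.length, (-1) ^ (j : ℕ) * f l[j] * pfSum a q (l.eraseIdx j) := by
  have e : kernelForm (fun i j => a i j + (f i * q j - q i * f j)) = kernelForm a +
      wedgeForm (Finsupp.linearCombination R f) (Finsupp.linearCombination R q) := by
    refine Finsupp.lhom_ext' fun i => LinearMap.ext_ring (Finsupp.lhom_ext' fun j =>
        LinearMap.ext_ring ?_)
    simp [kernelForm_single, wedgeForm_apply]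
  have hB := kernelForm_isAlt (fun i j => a i j + (f i * q j - q i * f j))
    (fun i => by simp [h0, mul_comm]) (fun i j => by simp only [h1 i j]; ring)
  rw [pfSum_eq_pfForm (fun i => by simp [h0, mul_comm]) (fun i j => by simp only [h1 i j]; ring)]
  have : ∀ B hB, B = kernelForm a +
      wedgeForm (Finsupp.linearCombination R f) (Finsupp.linearCombination R q) →
      ∀ x, pfForm B hB x = pfForm _ (kernelForm_isAlt a h0 h1) x + pfForm _
        (kernelForm_isAlt a h0 h1) (contractLeft (Finsupp.linearCombination R q)
          (contractLeft (Finsupp.linearCombination R f) x)) := by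
    rintro B hB rfl x
    exact pfForm_add_wedgeForm _ _ _ _ _ _
  rw [this _ _ e, sum_mul_pfSum_eraseIdx h0 h1, pf_eq_pfForm h0 h1]
  simp only [map_add, contractLeft_contractLeft, add_zero]
  ring

end Pfaffian

section

open MvPolynomial

/-! ### The scalar product as a bilinear form -/

/-- The squared norm of the power sum monomial with exponent `m`. -/
def wt (m : ℕ+ →₀ ℕ) : ℂ := m.prod fun k e => (k : ℂ) ^ e * (e.factorial : ℂ) / 2 ^ e

theorem wt_ne_zero (m : ℕ+ →₀ ℕ) : wt m ≠ 0 := by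
  rw [wt, Finsupp.prod, Finset.prod_ne_zero_iff]
  intro k _
  have : (k : ℂ) ≠ 0 := by simp
  simp [Nat.factorial_ne_zero]

theorem wt_add_single (m : ℕ+ →₀ ℕ) (k : ℕ+) :
    wt (m + Finsupp.single k 1) = wt m * ((k : ℂ) / 2 * (m k + 1)) := by
  have h0 : ∀ i : ℕ+, ((i : ℕ) : ℂ) ^ 0 * (Nat.factorial 0 : ℂ) / 2 ^ 0 = 1 := by simp
  have h1 : m + Finsupp.single k 1 = m.erase k + Finsupp.single k (m k + 1) := by
    conv_lhs => rw [← Finsupp.erase_add_single k m]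
    rw [add_assoc, ← Finsupp.single_add]
  have hd : ∀ n, Disjoint (m.erase k).support (Finsupp.single k n : ℕ+ →₀ ℕ).support := by
    intro n
    refine Finset.disjoint_of_subset_right Finsupp.support_single_subset ?_
    simp
  have h2 : wt m = wt (m.erase k) * wt (Finsupp.single k (m k)) := by
    conv_lhs => rw [← Finsupp.erase_add_single k m]
    rw [wt, Finsupp.prod_add_index_of_disjoint (hd _)]; rfl
  rw [h1, wt, Finsupp.prod_add_index_of_disjoint (hd _), h2]
  simp only [wt]
  rw [Finsupp.prod_single_index (h0 k), Finsupp.prod_single_index (h0 k)]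
  simp only [Nat.factorial_succ, pow_succ]
  push_cast
  field_simp

/-- The coercion in the body of `expParts` elaborates to a bind over singletons under an identity
map; this is the plain form used from here on. -/
theorem expParts_eq (m : ℕ+ →₀ ℕ) :
    expParts m = (Finsupp.toMultiset m).map fun k : ℕ+ => (k : ℕ) := by
  rw [expParts, Multiset.map_id']
  exact Multiset.bind_singleton _ _

theorem count_expParts (m : ℕ+ →₀ ℕ) (k : ℕ+) : (expParts m).count (k : ℕ) = m k := by
  rw [expParts_eq, Multiset.count_map_eq_count' _ _ PNat.coe_injective, Finsupp.count_toMultiset]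

theorem zee_expParts (m : ℕ+ →₀ ℕ) :
    (zee (expParts m) : ℂ) / 2 ^ Multiset.card (expParts m) = wt m := by
  have h1 : ((expParts m).prod : ℂ) = m.prod fun k e => (k : ℂ) ^ e := by
    rw [expParts_eq, Finsupp.toMultiset_map, Finsupp.prod_toMultiset,
      Finsupp.prod_mapDomain_index (by simp) (by intros; rw [pow_add])]
    simp [Finsupp.prod]
  have h2 : (Multiset.card (expParts m)) = m.sum fun _ e => e := by
    rw [expParts_eq, Multiset.card_map, Finsupp.card_toMultiset]; rfl
  have h3 : (expParts m).toFinset = m.support.image fun k : ℕ+ => (k : ℕ) := by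
    rw [expParts_eq, Multiset.toFinset_map, Finsupp.toFinset_toMultiset]
  rw [zee, h2, h3, Finset.prod_image (fun _ _ _ _ h => PNat.coe_injective h)]
  rw [Nat.cast_mul, h1]
  push_cast
  simp only [count_expParts, wt, Finsupp.prod, Finsupp.sum, ← Finset.prod_pow_eq_pow_sum,
    ← Finset.prod_mul_distrib, ← Finset.prod_div_distrib]

/-- The bilinear form with `⟨p_ρ, p_σ⟩ = 2^{-ℓ(ρ)} z_ρ δ_{ρσ}`. -/
def bil : SymFun →ₗ[ℂ] SymFun →ₗ[ℂ] ℂ :=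
  (basisMonomials ℕ+ ℂ).constr ℂ fun m => wt m • lcoeff ℂ m

theorem bil_monomial_left (m : ℕ+ →₀ ℕ) (c : ℂ) (G : SymFun) :
    bil (monomial m c) G = c * (wt m * G.coeff m) := by
  have : (monomial m c : SymFun) = c • basisMonomials ℕ+ ℂ m := by
    simp [smul_monomial]
  rw [this, map_smul, bil, Module.Basis.constr_basis]
  simp

theorem bil_monomial (m m' : ℕ+ →₀ ℕ) (c c' : ℂ) :
    bil (monomial m c) (monomial m' c') = if m = m' then c * c' * wt m else 0 := by
  rw [bil_monomial_left, coeff_monomial]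
  by_cases h : m = m'
  · simp [h]; ring
  · simp [h, Ne.symm h]

theorem bil_ext {N : Type*} [AddCommMonoid N] [Module ℂ N] {f g : SymFun →ₗ[ℂ] SymFun →ₗ[ℂ] N}
    (h : ∀ m m', f (monomial m 1) (monomial m' 1) = g (monomial m 1) (monomial m' 1)) : f = g := by
  refine (basisMonomials ℕ+ ℂ).ext fun m => (basisMonomials ℕ+ ℂ).ext fun m' => ?_
  simpa using h m m'

theorem bil_symm (F G : SymFun) : bil F G = bil G F := by
  have : bil = bil.flip := bil_ext fun m m' => by
    rw [LinearMap.flip_apply, bil_monomial, bil_monomial]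
    by_cases h : m = m'
    · simp [h]
    · simp [h, Ne.symm h]
  exact congrArg (fun b => b F G) this

/-- Raising the exponent of `p_k` from `e` to `e + 1` multiplies the norm by `(k/2)(e + 1)`, so the
adjoint of multiplication by `p_k` is `(k/2) ∂/∂p_k`. -/
theorem bil_X_mul (k : ℕ+) (F G : SymFun) :
    bil (X k * F) G = (k : ℂ) / 2 * bil F (pderiv k G) := by
  have : bil ∘ₗ LinearMap.mulLeft ℂ (X k : SymFun) =
      ((k : ℂ) / 2) • bil.compl₂ (pderiv k).toLinearMap := by
    refine bil_ext fun m m' => ?_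
    have e : (X k : SymFun) * monomial m 1 = monomial (m + Finsupp.single k 1) 1 := by
      rw [X, monomial_mul, one_mul, add_comm]
    simp only [LinearMap.comp_apply, LinearMap.mulLeft_apply, LinearMap.smul_apply,
      LinearMap.compl₂_apply, Derivation.coeFn_coe,
      pderiv_monomial, e, bil_monomial, smul_eq_mul]
    rcases Nat.eq_zero_or_pos (m' k) with h | h
    · have : m + Finsupp.single k 1 ≠ m' := by
        rintro rfl; simp at h
      simp [this, h]
    · have hm : m' = (m' - Finsupp.single k 1) + Finsupp.single k 1 :=
        (tsub_add_cancel_of_le (by rw [Finsupp.single_le_iff]; exact h)).symm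
      by_cases h2 : m = m' - Finsupp.single k 1
      · rw [if_pos h2, if_pos (by rw [h2, ← hm]), wt_add_single]
        have : (m' k : ℂ) = m k + 1 := by rw [hm, h2]; simp
        rw [this]; ring
      · rw [if_neg h2, if_neg]
        · simp
        · rintro rfl; exact h2 (by simp)
  simpa using congrArg (fun b => b F G) this

/-- Complex conjugation of the coefficients. -/
def conj : SymFun →+* SymFun := MvPolynomial.map (starRingEnd ℂ)

/-- This reduces the sesquilinear form to the symmetric bilinear one; the two agree whenever the
second argument has real coefficients. -/
theorem innerNegOne_eq_bil (F G : SymFun) : innerNegOne F G = bil F (conj G) := by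
  conv_rhs => rw [F.as_sum, map_sum, LinearMap.sum_apply]
  rw [innerNegOne]
  refine Finset.sum_congr rfl fun m _ => ?_
  rw [zee_expParts, bil_monomial_left, conj, coeff_map]
  ring

/-! ### Power sum products as monomials -/

/-- The exponent of the power sum product `p_ρ`. -/
def toExp (ρ : Multiset ℕ) : ℕ+ →₀ ℕ := Multiset.toFinsupp (ρ.map Nat.toPNat')

theorem powerSum_eq (ρ : Multiset ℕ) : powerSum ρ = monomial (toExp ρ) 1 := by
  induction ρ using Multiset.induction_on with
  | empty => simp [powerSum, toExp]
  | cons a ρ ih =>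
    have h : powerSum (a ::ₘ ρ) = X a.toPNat' * powerSum ρ := by simp [powerSum]
    have h' : toExp (a ::ₘ ρ) = Finsupp.single a.toPNat' 1 + toExp ρ := by
      rw [toExp, Multiset.map_cons, ← Multiset.singleton_add, Multiset.toFinsupp_add,
        Multiset.toFinsupp_singleton]
      rfl
    rw [h, ih, h', X, monomial_mul, one_mul]

theorem toExp_expParts (m : ℕ+ →₀ ℕ) : toExp (expParts m) = m := by
  rw [toExp, expParts_eq, Multiset.map_map]
  simp

theorem expParts_toExp (ρ : Multiset ℕ) (h : ∀ i ∈ ρ, 0 < i) : expParts (toExp ρ) = ρ := by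
  rw [toExp, expParts_eq, Multiset.toFinsupp_toMultiset, Multiset.map_map]
  conv_rhs => rw [← Multiset.map_id ρ]
  refine Multiset.map_congr rfl fun i hi => ?_
  simpa using PNat.toPNat'_coe (h i hi)

theorem expParts_pos (m : ℕ+ →₀ ℕ) : ∀ i ∈ expParts m, 0 < i := by
  intro i hi
  obtain ⟨k, _, rfl⟩ := Multiset.mem_map.1 (expParts_eq m ▸ hi)
  exact k.pos

theorem mem_expParts (m : ℕ+ →₀ ℕ) (k : ℕ+) : (k : ℕ) ∈ expParts m ↔ m k ≠ 0 := by
  rw [← Multiset.count_ne_zero, count_expParts]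

theorem expParts_add_single (m : ℕ+ →₀ ℕ) (k : ℕ+) :
    expParts (m + Finsupp.single k 1) = (k : ℕ) ::ₘ expParts m := by
  rw [expParts_eq, map_add, Multiset.map_add, Finsupp.toMultiset_single]
  simp [expParts_eq, add_comm, ← Multiset.singleton_add]

theorem sum_expParts (m : ℕ+ →₀ ℕ) : (expParts m).sum = m.sum fun k e => e * (k : ℕ) := by
  induction m using Finsupp.induction_linear with
  | zero => simp [expParts_eq]
  | add f g hf hg =>
    rw [Finsupp.sum_add_index' (by simp) (by intros; ring), ← hf, ← hg]
    simp [expParts_eq]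
  | single k e => simp [expParts_eq, Multiset.map_nsmul, Multiset.sum_nsmul]

/-! ### Coefficients of the `q n` and their Newton recurrence -/

theorem coeff_q (n : ℕ) (m : ℕ+ →₀ ℕ) :
    (q n).coeff m = if (expParts m).sum = n ∧ ∀ i ∈ expParts m, Odd i then (wt m)⁻¹ else 0 := by
  have hρ : ∀ ρ : n.Partition, toExp ρ.parts = m ↔ ρ.parts = expParts m := fun ρ =>
    ⟨fun h => by rw [← h, expParts_toExp _ fun i hi => ρ.parts_pos hi],
      fun h => by rw [h, toExp_expParts]⟩
  rw [q, coeff_sum]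
  simp only [coeff_smul, powerSum_eq, coeff_monomial, hρ, smul_eq_mul, mul_ite, mul_one, mul_zero]
  split_ifs with h
  · rw [Finset.sum_eq_single_of_mem (⟨expParts m, fun hi => expParts_pos m _ hi, h.1⟩ :
      n.Partition)]
    · rw [if_pos rfl, ← zee_expParts, inv_div]
    · simpa [Nat.Partition.odds, Nat.Partition.restricted] using h.2
    · intro ρ _ hne
      rw [if_neg]
      intro h'; exact hne (Nat.Partition.ext h')
  · refine Finset.sum_eq_zero fun ρ hmem => if_neg fun h' => h ?_
    rw [← h']
    exact ⟨ρ.parts_sum, by simpa [Nat.Partition.odds, Nat.Partition.restricted] using hmem⟩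

theorem q_zero : q 0 = 1 := by
  ext m
  rw [coeff_q, coeff_one]
  by_cases h : 0 = m
  · subst h; simp [expParts_eq, wt]
  · rw [if_neg h, if_neg]
    rintro ⟨h1, -⟩
    apply h
    ext k
    by_contra hk
    have := (mem_expParts m k).2 (Ne.symm hk)
    have := Multiset.single_le_sum (by simp) _ this
    have := k.pos
    omega

theorem sum_range_expParts (m : ℕ+ →₀ ℕ) (n : ℕ) (h : (expParts m).sum = n) :
    ∑ k ∈ Finset.range n, (k + 1) * m k.succPNat = n := by
  have hsub : m.support ⊆ (Finset.range n).image Nat.succPNat := by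
    intro k hk
    have h1 := Multiset.single_le_sum (by simp) _ ((mem_expParts m k).2 (by simpa using hk))
    have h2 := k.pos
    rw [Finset.mem_image]
    exact ⟨k.natPred, by simp [PNat.natPred]; omega, by simp⟩
  rw [sum_expParts, Finsupp.sum_of_support_subset _ hsub _ (by simp),
    Finset.sum_image (fun _ _ _ _ h => Nat.succPNat_injective h)] at h
  refine Eq.trans ?_ h
  exact Finset.sum_congr rfl fun k _ => by simp [mul_comm]

/-- The odd power sums as a sequence. -/
def oddPowerSum (k : ℕ) : SymFun := if Even k then X k.succPNat else 0

/-- This is `q'(u) = 2 (∑ p_k u^{k-1}) q(u)`, summed over odd `k`. Coefficientwise: deleting a part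
`k` from a monomial `m` multiplies `(wt m)⁻¹` by `k m_k / 2`, and the numbers `k m_k` add up to the
degree. The index in `oddPowerSum` is one less than that of the power sum. -/
theorem q_succ (n : ℕ) : ((n + 1 : ℕ) : ℂ) • q (n + 1) =
    ∑ k ∈ Finset.range (n + 1), 2 * (oddPowerSum k * q (n - k)) := by
  ext m
  rw [coeff_smul, coeff_sum, smul_eq_mul]
  have key : ∀ k ∈ Finset.range (n + 1), coeff m (2 * (oddPowerSum k * q (n - k))) =
      (if (expParts m).sum = n + 1 ∧ ∀ i ∈ expParts m, Odd i then (wt m)⁻¹ else 0) *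
        (((k + 1) * m k.succPNat : ℕ) : ℂ) := by
    intro k hk
    have hk' : k ≤ n := by simpa [Nat.lt_succ_iff] using hk
    have e2 : (2 : SymFun) = C 2 := (map_ofNat C 2).symm
    rw [e2, coeff_C_mul]
    rcases Nat.eq_zero_or_pos (m k.succPNat) with h0 | h0
    · rw [h0, oddPowerSum]
      split_ifs <;> simp [coeff_X_mul', h0]
    obtain ⟨m', rfl⟩ : ∃ m', m = m' + Finsupp.single k.succPNat 1 :=
      ⟨m - Finsupp.single k.succPNat 1,
        (tsub_add_cancel_of_le (by rw [Finsupp.single_le_iff]; exact h0)).symm⟩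
    rw [oddPowerSum]
    by_cases hev : Even k
    · rw [if_pos hev, add_comm m', coeff_X_mul, coeff_q, add_comm _ m', expParts_add_single]
      have hc : ((expParts m').sum = n - k ∧ ∀ i ∈ expParts m', Odd i) ↔
          ((((k.succPNat : ℕ+) : ℕ) ::ₘ expParts m').sum = n + 1 ∧
            ∀ i ∈ ((k.succPNat : ℕ+) : ℕ) ::ₘ expParts m', Odd i) := by
        have : Odd (k + 1) := hev.add_one
        simp only [Multiset.sum_cons, Multiset.mem_cons, forall_eq_or_imp, Nat.succPNat_coe,
          Nat.succ_eq_add_one, this, true_and]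
        refine and_congr ⟨fun h => by omega, fun h => by omega⟩ Iff.rfl
      simp only [hc]
      split_ifs with h
      · rw [wt_add_single]
        have h1 := wt_ne_zero m'
        have h2 : ((k : ℂ) + 1) ≠ 0 := by exact_mod_cast Nat.succ_ne_zero k
        have h3 : ((m' k.succPNat : ℂ) + 1) ≠ 0 := Nat.cast_add_one_ne_zero _
        simp
        field_simp
      · simp
    · rw [if_neg hev, if_neg]
      · simp
      · rintro ⟨-, h⟩
        have := h k.succPNat ((mem_expParts _ _).2 h0.ne')
        rw [Nat.succPNat_coe, Nat.succ_eq_add_one] at this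
        exact hev (by simpa [Nat.odd_add_one] using this)
  rw [Finset.sum_congr rfl key, ← Finset.mul_sum, ← Nat.cast_sum, coeff_q]
  split_ifs with h
  · rw [sum_range_expParts m _ h.1]; ring
  · simp

end

/-! ### Generating functions with an even logarithmic derivative -/

section PowerSeries

open PowerSeries

variable {S : Type*} [CommRing S]

theorem derivative_mk_eq (q P : ℕ → S)
    (hq : ∀ n, ((n + 1 : ℕ) : S) * q (n + 1) = ∑ k ∈ Finset.range (n + 1), P k * q (n - k)) :
    derivative S (mk q) = mk P * mk q := by
  ext n
  rw [coeff_derivative, coeff_mk, coeff_mul, Finset.Nat.sum_antidiagonal_eq_sum_range_succ_mk]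
  simp only [coeff_mk]
  rw [← hq]
  push_cast
  ring

theorem derivative_mk_neg (q P : ℕ → S) (hP : ∀ k, ¬ Even k → P k = 0)
    (hq : ∀ n, ((n + 1 : ℕ) : S) * q (n + 1) = ∑ k ∈ Finset.range (n + 1), P k * q (n - k)) :
    derivative S (mk fun n => (-1) ^ n * q n) = -(mk P * mk fun n => (-1) ^ n * q n) := by
  rw [← neg_mul]
  have : -(mk P) = mk fun k => -P k := by ext; simp
  rw [this]
  refine derivative_mk_eq _ _ fun n => ?_
  rw [mul_left_comm, hq, Finset.mul_sum]
  refine Finset.sum_congr rfl fun k hk => ?_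
  have hk : k ≤ n := by simpa [Nat.lt_succ_iff] using hk
  by_cases he : Even k
  · have : n + 1 = (n - k) + k + 1 := by omega
    rw [this, pow_succ, pow_add, he.neg_one_pow]
    simp
    ring
  · simp [hP k he]

variable [IsAddTorsionFree S]

/-- The logarithmic derivatives `P` and `-P` cancel, so the product `q(u) q(-u)` is constant. -/
theorem mk_mul_mk_neg (q P : ℕ → S) (h0 : q 0 = 1) (hP : ∀ k, ¬ Even k → P k = 0)
    (hq : ∀ n, ((n + 1 : ℕ) : S) * q (n + 1) = ∑ k ∈ Finset.range (n + 1), P k * q (n - k)) :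
    (mk q * mk fun n => (-1) ^ n * q n) = 1 := by
  refine derivative.ext ?_ ?_
  · rw [Derivation.leibniz, derivative_mk_eq q P hq, derivative_mk_neg q P hP hq,
      derivative_one, smul_eq_mul, smul_eq_mul]
    ring
  · simp [h0]

/-- If `q(u)` has the logarithmic derivative `P(u)`, even in `u`, and `f(u)` has the logarithmic
derivative `P(u) + 2 v / (1 - u² v²)`, then `f(u) (1 - u v) = q(u) (1 + u v)`. -/
theorem sub_eq_mul_add_of_derivative (q f P : ℕ → S) (v : S) (hq0 : q 0 = 1) (hf0 : f 0 = 1)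
    (hP : ∀ k, ¬ Even k → P k = 0)
    (hq : ∀ n, ((n + 1 : ℕ) : S) * q (n + 1) = ∑ k ∈ Finset.range (n + 1), P k * q (n - k))
    (hf : ∀ n, ((n + 1 : ℕ) : S) * f (n + 1) = ∑ k ∈ Finset.range (n + 1),
      (P k + if Even k then 2 * v ^ (k + 1) else 0) * f (n - k)) (n : ℕ) :
    f (n + 1) - q (n + 1) = v * (f n + q n) := by
  -- `N` is `q(-u) = 1/q(u)` and `T` is `2v / (1 - u²v²)`; the quotient `f N` then has logarithmic
  -- derivative `T`.
  set N : S⟦X⟧ := mk fun n => (-1) ^ n * q n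
  set T : S⟦X⟧ := mk fun k => if Even k then 2 * v ^ (k + 1) else 0
  have hT : (1 - C v ^ 2 * X ^ 2) * T = C (2 * v) := by
    ext n
    rw [sub_mul, one_mul, map_sub, mul_assoc, ← map_pow, coeff_C_mul, mul_comm (X ^ 2),
      coeff_C]
    match n with
    | 0 => simp [T, coeff_mul_X_pow']
    | 1 => simp [T, coeff_mul_X_pow']
    | n + 2 =>
      rw [coeff_mul_X_pow, if_neg (by omega)]
      simp only [T, coeff_mk, Nat.even_add, even_two, iff_true]
      split_ifs
      · ring
      · ring
  have hF : derivative S (mk f) = (mk P + T) * mk f := by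
    rw [derivative_mk_eq f _ hf]; congr 1
  have hN := derivative_mk_neg q P hP hq
  set h : S⟦X⟧ := mk f * N
  have hh : derivative S h = T * h := by
    rw [Derivation.leibniz, hF, hN, smul_eq_mul, smul_eq_mul]; ring
  -- The quotient `h` should be `(1 + uv)/(1 - uv)`. Clearing the denominator leaves the equation
  -- `(1 + uv) g' = v g`, whose solution is to be the polynomial `1 + uv`.
  set g : S⟦X⟧ := (1 - C v * X) * h
  have hg : (1 + C v * X) * derivative S g = C v * g := by
    have e1 : derivative S (1 - C v * X) = -C v := by
      rw [map_sub, derivative_one, Derivation.leibniz]; simp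
    have e2 : (C (2 * v) : S⟦X⟧) = 2 * C v := by rw [map_mul, map_ofNat]
    rw [Derivation.leibniz, e1, hh, smul_eq_mul, smul_eq_mul]
    linear_combination h * hT + h * e2
  have hgc : ∀ n, ((n + 1 : ℕ) : S) * coeff (n + 1) g = v * (1 - n) * coeff n g := by
    intro n
    have := congrArg (coeff n) hg
    rw [add_mul, one_mul, map_add, coeff_C_mul, coeff_derivative, mul_assoc, coeff_C_mul] at this
    cases n with
    | zero =>
      rw [coeff_zero_X_mul] at this
      linear_combination this
    | succ n =>
      rw [coeff_succ_X_mul, coeff_derivative] at this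
      push_cast at this ⊢
      linear_combination this
  have hg0 : coeff 0 g = 1 := by simp [g, h, N, hf0, hq0]
  have hg1 : coeff 1 g = v := by simpa [hg0] using hgc 0
  -- The factor `1 - n` in `hgc` vanishes at `n = 1`, so the coefficient of `u²` is zero and all
  -- later ones follow.
  have hg2 : ∀ n, coeff (n + 2) g = 0 := by
    intro n
    induction n with
    | zero =>
      have := hgc 1
      simp only [Nat.cast_one, sub_self, mul_zero, zero_mul] at this
      rw [← nsmul_eq_mul] at this
      exact (nsmul_eq_zero_iff_right (by norm_num)).1 this
    | succ n ih =>
      have := hgc (n + 2)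
      rw [ih, mul_zero, ← nsmul_eq_mul] at this
      exact (nsmul_eq_zero_iff_right (by omega)).1 this
  have hgv : g = 1 + C v * X := by
    ext n
    match n with
    | 0 => simp [hg0]
    | 1 => rw [hg1]; simp [coeff_one]
    | n + 2 => rw [hg2]; simp [coeff_one]
  have hfin : (1 - C v * X) * mk f = (1 + C v * X) * mk q := by
    have h1 : mk q * N = 1 := mk_mul_mk_neg q P hq0 hP hq
    have h2 : (1 - C v * X) * (mk f * N) = 1 + C v * X := hgv
    linear_combination (mk q) * h2 - (1 - C v * X) * mk f * h1
  have := congrArg (coeff (n + 1)) hfin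
  rw [sub_mul, add_mul, one_mul, one_mul, map_sub, map_add, mul_assoc, mul_assoc, coeff_C_mul,
    coeff_C_mul, coeff_succ_X_mul, coeff_succ_X_mul] at this
  simp only [coeff_mk] at this
  linear_combination this

end PowerSeries

/-! ### The shift of the odd power sums -/

open Polynomial in
/-- The substitution `p_k ↦ p_k + v^k` (`k` odd), `p_k ↦ p_k` (`k` even). It is the generating
function `∑ vⁿ qₙ^⊥` of the adjoints of the multiplications by the `qₙ`. -/
def shift : SymFun →ₐ[ℂ] Polynomial SymFun :=
  MvPolynomial.aeval fun k : ℕ+ =>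
    Polynomial.C (MvPolynomial.X k) + if Odd (k : ℕ) then Polynomial.X ^ (k : ℕ) else 0

theorem shift_X (k : ℕ+) : shift (MvPolynomial.X k) = Polynomial.C (MvPolynomial.X k) +
    if Odd (k : ℕ) then Polynomial.X ^ (k : ℕ) else 0 := by
  simp [shift]

theorem shift_oddPowerSum (k : ℕ) : shift (oddPowerSum k) =
    Polynomial.C (oddPowerSum k) + if Even k then Polynomial.X ^ (k + 1) else 0 := by
  rw [oddPowerSum]
  split_ifs with h
  · rw [shift_X, if_pos (by simpa using h.add_one)]; simp
  · simp

/-- The recurrence of the `q n` gives `shift (q(u))` the extra logarithmic derivative `2v / (1 -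
u²v²)`, so `sub_eq_mul_add_of_derivative` applies with `v` the polynomial variable. -/
theorem shift_q_succ (n : ℕ) : shift (q (n + 1)) - Polynomial.C (q (n + 1)) =
    Polynomial.X * (shift (q n) + Polynomial.C (q n)) := by
  have hq : ∀ n, ((n + 1 : ℕ) : SymFun) * q (n + 1) =
      ∑ k ∈ Finset.range (n + 1), 2 * oddPowerSum k * q (n - k) := by
    intro n
    have := q_succ n
    rw [Nat.cast_smul_eq_nsmul, nsmul_eq_mul] at this
    rw [this]
    exact Finset.sum_congr rfl fun k _ => by ring
  refine sub_eq_mul_add_of_derivative (fun n => Polynomial.C (q n)) (fun n => shift (q n))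
    (fun k => Polynomial.C (2 * oddPowerSum k)) Polynomial.X ?_ ?_ ?_ ?_ ?_ n
  · simp [q_zero]
  · simp [q_zero]
  · intro k hk; simp [oddPowerSum, hk]
  · intro n
    have := congrArg (Polynomial.C : SymFun →+* Polynomial SymFun) (hq n)
    simpa using this
  · intro n
    have := congrArg shift (hq n)
    simp only [map_mul, map_natCast, map_sum, map_ofNat, shift_oddPowerSum] at this
    rw [this]
    refine Finset.sum_congr rfl fun k _ => ?_
    rw [map_mul, map_ofNat]
    split_ifs <;> ring

theorem natDegree_shift_q_le (n : ℕ) : (shift (q n)).natDegree ≤ n := by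
  induction n with
  | zero => simp [q_zero]
  | succ n ih =>
    rw [eq_add_of_sub_eq (shift_q_succ n)]
    refine Polynomial.natDegree_add_le_of_degree_le ?_ (by simp)
    refine Polynomial.natDegree_mul_le.trans ?_
    have : (shift (q n) + Polynomial.C (q n)).natDegree ≤ n :=
      Polynomial.natDegree_add_le_of_degree_le ih (by simp)
    have h2 : (Polynomial.X : Polynomial SymFun).natDegree ≤ 1 := Polynomial.natDegree_X_le
    omega

theorem coeff_shift_q_self (n : ℕ) : (shift (q (n + 1))).coeff (n + 1) = 2 := by
  induction n with
  | zero =>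
    rw [eq_add_of_sub_eq (shift_q_succ 0)]
    simp [q_zero, Polynomial.coeff_one]; norm_num
  | succ n ih =>
    rw [eq_add_of_sub_eq (shift_q_succ (n + 1))]
    simp [ih]

/-- The two alternating sums cancel after a shift of the summation index. No order between `r` and
`s` is needed, which permits induction on `s` with `r` growing. -/
theorem qPair_succ (r s : ℕ) : qPair r (s + 1) + qPair (r + 1) s =
    q r * q (s + 1) - q (r + 1) * q s := by
  have h : ∑ i ∈ Finset.Icc 1 (s + 1), (-1) ^ i * (q (r + i) * q (s + 1 - i)) =
      -(q (r + 1) * q s) - ∑ i ∈ Finset.Icc 1 s, (-1) ^ i * (q (r + 1 + i) * q (s - i)) := by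
    rw [← Finset.add_sum_Ioc_eq_sum_Icc (by omega), sub_eq_add_neg, ← Finset.sum_neg_distrib]
    congr 1
    · simp
    · refine (Finset.sum_bij (fun i _ => i + 1) ?_ ?_ ?_ ?_).symm
      · intro i hi; simp at hi ⊢; omega
      · intro i _ j _ h; simpa using h
      · intro j hj; simp at hj; exact ⟨j - 1, by simp; omega, by omega⟩
      · intro i hi
        rw [pow_succ, show r + (i + 1) = r + 1 + i by ring, show s + 1 - (i + 1) = s - i by omega]
        ring
  rw [qPair, qPair, h]
  ring

theorem qPair_zero (r : ℕ) : qPair r 0 = q r := by simp [qPair, q_zero]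

/-- With `D` for `shift`, the induction closes because `(D q_r + q_r)(D q_{s+1} - q_{s+1})` and `(D
q_s + q_s)(D q_{r+1} - q_{r+1})` both equal `v (D q_r + q_r)(D q_s + q_s)`. -/
theorem shift_qPair (r s : ℕ) : shift (qPair r s) = Polynomial.C (qPair r s) +
    (shift (q r) * Polynomial.C (q s) - Polynomial.C (q r) * shift (q s)) := by
  induction s generalizing r with
  | zero => simp [qPair_zero, q_zero]
  | succ s ih =>
    have e : qPair r (s + 1) = q r * q (s + 1) - q (r + 1) * q s - qPair (r + 1) s :=
      eq_sub_of_add_eq (qPair_succ r s)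
    have h1 := shift_q_succ r
    have h2 := shift_q_succ s
    rw [e, map_sub, map_sub, ih, map_sub, map_sub, map_mul, map_mul, map_mul, map_mul]
    linear_combination (shift (q r) + Polynomial.C (q r)) * h2 -
      (shift (q s) + Polynomial.C (q s)) * h1

section

open MvPolynomial

/-! ### The adjoints of the multiplications by the `qₙ` -/

/-- This is the chain rule `d/dv D(G) = ∑ k v^{k-1} D(∂G/∂p_k)` over odd `k`, with `D` for `shift`.
Working modulo `v^N` keeps the sum over a range that does not depend on `G`. -/
theorem X_pow_dvd_derivative_shift_sub (N : ℕ) (G : SymFun) :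
    (Polynomial.X ^ N : Polynomial SymFun) ∣ Polynomial.derivative (shift G) -
      ∑ k ∈ Finset.range N, if Even k then
        ((k + 1 : ℕ) : Polynomial SymFun) * Polynomial.X ^ k * shift (pderiv k.succPNat G)
        else 0 := by
  induction G using MvPolynomial.induction_on with
  | C a =>
    have : shift (C a) = Polynomial.C (C a) := by
      rw [← MvPolynomial.algebraMap_eq, AlgHom.commutes]; rfl
    simp [this]
  | add p q hp hq =>
    convert dvd_add hp hq using 1
    rw [map_add, Polynomial.derivative_add, sub_add_sub_comm, ← Finset.sum_add_distrib]
    congr 1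
    refine Finset.sum_congr rfl fun k _ => ?_
    split_ifs
    · rw [map_add, map_add]; ring
    · simp
  | mul_X p j hp =>
    have hj : (Polynomial.X ^ N : Polynomial SymFun) ∣ Polynomial.derivative (shift (X j)) -
      ∑ k ∈ Finset.range N, if Even k then
        ((k + 1 : ℕ) : Polynomial SymFun) * Polynomial.X ^ k * shift (pderiv k.succPNat (X j))
        else 0 := by
      obtain ⟨j, rfl⟩ : ∃ i : ℕ, j = i.succPNat := ⟨j.natPred, by simp⟩
      have e1 : Polynomial.derivative (shift (X j.succPNat)) =
          if Even j then ((j + 1 : ℕ) : Polynomial SymFun) * Polynomial.X ^ j else 0 := by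
        rw [shift_X]
        by_cases h : Even j
        · rw [if_pos h, if_pos (by simpa using h.add_one)]
          simp
        · rw [if_neg h, if_neg (by simpa [Nat.odd_add_one] using h)]
          simp
      have e2 : ∀ k : ℕ, shift (pderiv k.succPNat (X j.succPNat)) =
          if k = j then 1 else 0 := by
        intro k
        rw [pderiv_X]
        by_cases h : k = j
        · simp [h]
        · simp [h, Ne.symm h]
      rw [e1]
      simp only [e2, mul_ite, mul_one, mul_zero, ← ite_and]
      by_cases hjN : j < N
      · rw [Finset.sum_eq_single_of_mem j (by simpa using hjN)
          (fun k _ hk => by rw [if_neg (fun h => hk h.2)])]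
        simp
      · rw [Finset.sum_eq_zero, sub_zero]
        · split_ifs
          · exact Dvd.dvd.mul_left (pow_dvd_pow _ (by omega)) _
          · exact dvd_zero _
        · intro k hk
          rw [if_neg]
          rintro ⟨-, rfl⟩
          exact hjN (by simpa using hk)
    convert dvd_add (Dvd.dvd.mul_right hp (shift (X j))) (Dvd.dvd.mul_left hj (shift p)) using 1
    rw [map_mul, Polynomial.derivative_mul, sub_mul, mul_sub, sub_add_sub_comm, Finset.sum_mul,
      Finset.mul_sum, ← Finset.sum_add_distrib]
    congr 1
    refine Finset.sum_congr rfl fun k _ => ?_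
    split_ifs
    · rw [Derivation.leibniz, map_add, smul_eq_mul, smul_eq_mul, map_mul, map_mul]; ring
    · simp

theorem coeff_shift_succ (n : ℕ) (G : SymFun) :
    ((n + 1 : ℕ) : ℂ) • (shift G).coeff (n + 1) = ∑ k ∈ Finset.range (n + 1), if Even k then
      ((k + 1 : ℕ) : ℂ) • (shift (pderiv k.succPNat G)).coeff (n - k) else 0 := by
  have h := Polynomial.X_pow_dvd_iff.1 (X_pow_dvd_derivative_shift_sub (n + 1) G) n (by omega)
  rw [Polynomial.coeff_sub, sub_eq_zero, Polynomial.coeff_derivative,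
    Polynomial.finsetSum_coeff] at h
  rw [Nat.cast_smul_eq_nsmul, nsmul_eq_mul]
  push_cast
  rw [mul_comm, h]
  refine Finset.sum_congr rfl fun k hk => ?_
  have hk : k ≤ n := by simpa [Nat.lt_succ_iff] using hk
  split_ifs
  · rw [mul_assoc, ← nsmul_eq_mul, Polynomial.coeff_smul, Polynomial.coeff_X_pow_mul',
      if_pos hk, ← Nat.cast_smul_eq_nsmul ℂ]
    push_cast
    rfl
  · simp

/-- The recurrence `q_succ` and the chain rule `coeff_shift_succ` match term by term, since `2 p_k`
is adjoint to `k ∂/∂p_k`. -/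
theorem bil_q_mul (n : ℕ) (F G : SymFun) :
    bil (q n * F) G = bil F ((shift G).coeff n) := by
  induction n using Nat.strong_induction_on generalizing F G with
  | _ n ih =>
  match n with
  | 0 =>
    have : (shift G).coeff 0 = G := by
      induction G using MvPolynomial.induction_on with
      | C a =>
        have : shift (C a) = Polynomial.C (C a) := by
          rw [← MvPolynomial.algebraMap_eq, AlgHom.commutes]; rfl
        simp [this]
      | add p q hp hq => rw [map_add, Polynomial.coeff_add, hp, hq]
      | mul_X p j hp =>
        rw [map_mul, Polynomial.mul_coeff_zero, hp, shift_X]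
        split_ifs <;> simp [Polynomial.coeff_X_pow, j.ne_zero.symm]
    rw [q_zero, one_mul, this]
  | n + 1 =>
    have hn : ((n + 1 : ℕ) : ℂ) ≠ 0 := Nat.cast_ne_zero.2 (by omega)
    refine mul_left_cancel₀ hn ?_
    have e1 : ((n + 1 : ℕ) : ℂ) * bil (q (n + 1) * F) G =
        bil ((((n + 1 : ℕ) : ℂ) • q (n + 1)) * F) G := by
      rw [smul_mul_assoc, map_smul, LinearMap.smul_apply, smul_eq_mul]
    have e2 : ((n + 1 : ℕ) : ℂ) * bil F ((shift G).coeff (n + 1)) =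
        bil F (((n + 1 : ℕ) : ℂ) • (shift G).coeff (n + 1)) := by
      rw [map_smul, smul_eq_mul]
    rw [e1, e2, q_succ, coeff_shift_succ, Finset.sum_mul, map_sum, map_sum, LinearMap.sum_apply]
    refine Finset.sum_congr rfl fun k _ => ?_
    rw [oddPowerSum]
    split_ifs
    · have e3 : 2 * (X k.succPNat * q (n - k)) * F = (2 : ℂ) • (X k.succPNat * (q (n - k) * F)) := by
        rw [ofNat_smul_eq_nsmul, nsmul_eq_mul]; push_cast; ring
      rw [e3, map_smul, LinearMap.smul_apply, bil_X_mul, ih (n - k) (by omega), map_smul]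
      simp
      ring
    · simp

/-! ### Orthogonality of Schur's `Q`-functions -/

/-- The skew-symmetric kernel `Q_{(r,s)}`. -/
def qKernel (r s : ℕ) : SymFun :=
  if s < r then qPair r s else if r < s then -qPair s r else 0

theorem qKernel_self (r : ℕ) : qKernel r r = 0 := by simp [qKernel]

theorem qKernel_skew (r s : ℕ) : qKernel r s = -qKernel s r := by
  unfold qKernel
  split_ifs <;> first | omega | simp

theorem shift_qKernel (r s : ℕ) : shift (qKernel r s) = Polynomial.C (qKernel r s) +
    (shift (q r) * Polynomial.C (q s) - Polynomial.C (q r) * shift (q s)) := by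
  rcases lt_trichotomy s r with h | rfl | h
  · rw [qKernel, if_pos h, shift_qPair]
  · rw [qKernel_self]; simp; ring
  · rw [qKernel, if_neg (by omega), if_pos h, map_neg, shift_qPair, map_neg]; ring

/-- Schur's `Q`-function indexed by a list. -/
def schurQList (l : List ℕ) : SymFun := pfSum qKernel q l

/-- Applying the homomorphism to the kernel adds the rank two term of `shift_qKernel`, with `f =
shift (q ·)` also serving as the new border; this is the situation of `pfSum_shift`. -/
theorem shift_schurQList (l : List ℕ) : shift (schurQList l) = Polynomial.C (pf qKernel l) +
    ∑ j : Fin l.length, (-1) ^ (j : ℕ) * shift (q l[j]) *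
      Polynomial.C (schurQList (l.eraseIdx j)) := by
  have h := map_pfSum (shift : SymFun →+* Polynomial SymFun) qKernel q l
  simp only [RingHom.coe_coe, shift_qKernel] at h
  rw [schurQList, h, pfSum_shift (a := fun i j => Polynomial.C (qKernel i j))
    (fun i => by simp [qKernel_self]) (fun i j => by rw [qKernel_skew i j, map_neg]), map_pf]
  simp only [schurQList, map_pfSum]

theorem coeff_shift_schurQList (l : List ℕ) (n : ℕ) (hn : 0 < n) :
    (shift (schurQList l)).coeff n = ∑ j : Fin l.length,
      (-1) ^ (j : ℕ) * (shift (q l[j])).coeff n * schurQList (l.eraseIdx j) := by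
  rw [shift_schurQList, Polynomial.coeff_add, Polynomial.coeff_C, if_neg hn.ne', zero_add,
    Polynomial.finsetSum_coeff]
  refine Finset.sum_congr rfl fun j _ => ?_
  have h : (-1 : Polynomial SymFun) ^ (j : ℕ) = Polynomial.C ((-1) ^ (j : ℕ)) := by simp
  rw [Polynomial.coeff_mul_C, h, Polynomial.coeff_C_mul]

theorem coeff_shift_schurQList_of_lt (l : List ℕ) (n : ℕ) (hn : 0 < n) (hl : ∀ i ∈ l, i < n) :
    (shift (schurQList l)).coeff n = 0 := by
  rw [coeff_shift_schurQList l n hn]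
  refine Finset.sum_eq_zero fun j _ => ?_
  rw [Polynomial.coeff_eq_zero_of_natDegree_lt
    ((natDegree_shift_q_le _).trans_lt (hl l[j] (List.getElem_mem _)))]
  simp

/-- For degree reasons only the removal of the first entry reaches `v^n`, with the top coefficient
`2` of `shift (q n)`. -/
theorem coeff_shift_schurQList_cons (l : List ℕ) (n : ℕ) (hn : 0 < n) (hl : ∀ i ∈ l, i < n) :
    (shift (schurQList (n :: l))).coeff n = 2 * schurQList l := by
  rw [coeff_shift_schurQList _ n hn]
  have : Finset.univ.sum (fun j : Fin (n :: l).length => (-1 : SymFun) ^ (j : ℕ) *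
      (shift (q (n :: l)[j])).coeff n * schurQList ((n :: l).eraseIdx j)) =
      ∑ j : Fin (l.length + 1), (-1 : SymFun) ^ (j : ℕ) *
      (shift (q (n :: l)[(j : ℕ)])).coeff n * schurQList ((n :: l).eraseIdx j) := rfl
  rw [this, Fin.sum_univ_succ, Finset.sum_eq_zero]
  · obtain ⟨n, rfl⟩ := Nat.exists_eq_succ_of_ne_zero hn.ne'
    simp [coeff_shift_q_self]
  · intro j _
    simp only [Fin.val_succ, List.getElem_cons_succ]
    rw [Polynomial.coeff_eq_zero_of_natDegree_lt
      ((natDegree_shift_q_le _).trans_lt (hl _ (List.getElem_mem _)))]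
    simp

/-- Every term of `Q_{(m,s)}` except `q_m q_s` contains some `q_{m+i}` with `i ≥ 1`, whose adjoint
kills `G`. -/
theorem bil_qPair_mul (m s : ℕ) (F G H : SymFun) (hG : ∀ n, m < n → (shift G).coeff n = 0)
    (hm : (shift G).coeff m = H) : bil (qPair m s * F) G = bil (q s * F) H := by
  rw [qPair, add_mul, mul_assoc, map_add, LinearMap.add_apply, bil_q_mul, hm]
  convert add_zero _
  rw [mul_assoc, Finset.sum_mul, Finset.mul_sum, map_sum, LinearMap.sum_apply]
  refine Finset.sum_eq_zero fun i hi => ?_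
  have hi : 1 ≤ i := (Finset.mem_Icc.1 hi).1
  have : 2 * ((-1) ^ i * (q (m + i) * q (s - i)) * F) =
      q (m + i) * (2 * (-1) ^ i * q (s - i) * F) := by ring
  rw [this, bil_q_mul, hG _ (by omega), map_zero]

/-- Against such a `G`, first-row expansion lets each `Q_{(m,s)}` act as `q_m q_s`. What remains is
`q_m` times the expansion of `Q_l` in `pfSum_eq_sum`. -/
theorem bil_schurQList_cons_mul (m : ℕ) (l : List ℕ) (hl : ∀ i ∈ l, i < m) (h G H : SymFun)
    (hG : ∀ n, m < n → (shift G).coeff n = 0) (hm : (shift G).coeff m = H) :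
    bil (schurQList (m :: l) * h) G = bil (schurQList l * h) H := by
  have key : ∀ (j : Fin l.length) (F : SymFun),
      bil ((-1) ^ (j : ℕ) * qKernel m l[j] * F) G = bil ((-1) ^ (j : ℕ) * q l[j] * F) H := by
    intro j F
    rw [qKernel, if_pos (hl l[j] (List.getElem_mem _))]
    rw [mul_comm ((-1) ^ (j : ℕ)), mul_comm ((-1) ^ (j : ℕ)), mul_assoc, mul_assoc,
      bil_qPair_mul _ _ _ _ _ hG hm]
  rw [schurQList, schurQList, pfSum_cons qKernel_self qKernel_skew,
    pfSum_eq_sum qKernel_self qKernel_skew, add_mul, add_mul, map_add, map_add,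
    LinearMap.add_apply, LinearMap.add_apply, mul_assoc, bil_q_mul, hm, Finset.sum_mul,
    Finset.sum_mul, map_sum, map_sum, LinearMap.sum_apply, LinearMap.sum_apply]
  refine congrArg₂ (· + ·) rfl (Finset.sum_congr rfl fun j _ => ?_)
  rw [mul_assoc, key, ← mul_assoc]

theorem bil_schurQList_mul (l l' : List ℕ) (hl : l.Pairwise (· > ·)) (hl' : l'.Pairwise (· > ·))
    (hpos : ∀ i ∈ l, 0 < i) (hpos' : ∀ i ∈ l', 0 < i) (h g : SymFun)
    (hh : shift h = Polynomial.C h) (hg : shift g = Polynomial.C g) :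
    bil (schurQList l * h) (schurQList l' * g) = if l = l' then 2 ^ l.length * bil h g else 0 := by
  have hc : ∀ (l : List ℕ) (g : SymFun), shift g = Polynomial.C g → ∀ n,
      (shift (schurQList l * g)).coeff n = (shift (schurQList l)).coeff n * g := by
    intro l g hg n
    rw [map_mul, hg, Polynomial.coeff_mul_C]
  -- If the largest part occurs on one side only, its adjoint annihilates the other side.
  have hlt : ∀ (m : ℕ) (l l' : List ℕ) (h g : SymFun), shift g = Polynomial.C g →
      (∀ i ∈ l, i < m) → (∀ i ∈ l', i < m) → 0 < m →
      bil (schurQList (m :: l) * h) (schurQList l' * g) = 0 := by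
    intro m l l' h g hg hl hl' hm
    rw [bil_schurQList_cons_mul m l hl h _ 0, map_zero]
    · intro n hn
      rw [hc _ _ hg, coeff_shift_schurQList_of_lt _ _ (by omega)
        (fun i hi => (hl' i hi).trans hn), zero_mul]
    · rw [hc _ _ hg, coeff_shift_schurQList_of_lt _ _ hm hl', zero_mul]
  induction l generalizing l' with
  | nil =>
    cases l' with
    | nil => simp [schurQList, pfSum_nil]
    | cons k t =>
      rw [bil_symm, hlt k t [] g h hh (List.pairwise_cons.1 hl').1 (by simp)
        (hpos' k (by simp))]
      simp
  | cons m l ih =>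
    obtain ⟨hml, hl2⟩ := List.pairwise_cons.1 hl
    have hm : 0 < m := hpos m (by simp)
    cases l' with
    | nil =>
      rw [hlt m l [] h g hg hml (by simp) hm]
      simp
    | cons k t =>
      obtain ⟨hkt, ht⟩ := List.pairwise_cons.1 hl'
      rcases lt_trichotomy k m with hkm | rfl | hkm
      · rw [hlt m l (k :: t) h g hg hml _ hm, if_neg]
        · rintro h; simp at h; omega
        · simp only [List.mem_cons, forall_eq_or_imp]
          exact ⟨hkm, fun i hi => (hkt i hi).trans hkm⟩
      -- Equal largest parts: moving `q_k` across strips the part on both sides and leaves the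
      -- factor `2`.
      · rw [bil_schurQList_cons_mul k l hml h _ ((2 : ℂ) • (schurQList t * g)), map_smul,
          ih t hl2 ht (fun i hi => hpos i (by simp [hi])) (fun i hi => hpos' i (by simp [hi]))]
        · simp only [List.cons.injEq, true_and, List.length_cons, pow_succ]
          split_ifs
          · simp; ring
          · simp
        · intro n hn
          rw [hc _ _ hg, coeff_shift_schurQList_of_lt _ _ (by omega), zero_mul]
          simp only [List.mem_cons, forall_eq_or_imp]
          exact ⟨hn, fun i hi => (hkt i hi).trans hn⟩
        · rw [hc _ _ hg, coeff_shift_schurQList_cons _ _ hm hkt, ofNat_smul_eq_nsmul,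
            nsmul_eq_mul]
          push_cast; ring
      · rw [bil_symm, hlt k t (m :: l) g h hh hkt _ (by omega), if_neg]
        · rintro h; simp at h; omega
        · simp only [List.mem_cons, forall_eq_or_imp]
          exact ⟨hkm, fun i hi => (hml i hi).trans hkm⟩

end

section

open MvPolynomial

/-! ### Schur's `Q`-function of a strict partition -/

/-- The list `l'` is either `l` or `l` with a final `0`; the default value `0` of `getD` makes the
two indistinguishable. -/
theorem qMatrix_eq_kernelMatrix (l l' : List ℕ) (hl' : l'.Pairwise (· > ·))
    (h : ∀ i, l.getD i 0 = l'.getD i 0) :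
    qMatrix l l'.length = kernelMatrix qKernel l' l'.length := by
  have hlt : ∀ i j : Fin l'.length, i < j → l'.getD j 0 < l'.getD i 0 := by
    intro i j hij
    simpa using List.pairwise_iff_getElem.1 hl' i j i.2 j.2 hij
  ext1 i j
  simp only [qMatrix, kernelMatrix, Matrix.of_apply, h]
  rcases lt_trichotomy i j with hij | rfl | hij
  · rw [if_pos hij, qKernel, if_pos (hlt _ _ hij)]
  · simp [qKernel_self]
  · rw [if_neg hij.asymm, if_pos hij, qKernel, if_neg (hlt _ _ hij).asymm, if_pos (hlt _ _ hij)]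

/-- For even length the border terms of `pfSum` are Pfaffians of odd size and vanish. For odd length
the padding index `0` is the border, because `Q_{(r,0)} = q_r`. -/
theorem pfaffian_qMatrix (l : List ℕ) (hl : l.Pairwise (· > ·)) (hpos : ∀ i ∈ l, 0 < i) :
    pfaffian (2 * ((l.length + 1) / 2)) (qMatrix l (2 * ((l.length + 1) / 2))) =
      schurQList l := by
  rcases Nat.even_or_odd l.length with he | ho
  · have hk : 2 * ((l.length + 1) / 2) = l.length := by grind
    rw [hk, qMatrix_eq_kernelMatrix l l hl (fun _ => rfl), schurQList, pfSum, Finset.sum_eq_zero,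
      add_zero]
    · rfl
    · intro j _
      rw [pf_odd qKernel_self qKernel_skew, mul_zero]
      have := j.2
      simp only [List.length_eraseIdx, j.2, if_true]
      grind
  · have hk : 2 * ((l.length + 1) / 2) = (l ++ [0]).length := by
      rw [List.length_append, List.length_singleton]; grind
    rw [hk, qMatrix_eq_kernelMatrix l (l ++ [0])]
    · change pf qKernel (l ++ [0]) = _
      rw [pf_append_singleton qKernel_self qKernel_skew, ho.neg_one_pow, schurQList, pfSum,
        pf_odd qKernel_self qKernel_skew l ho, zero_add, pf_cons qKernel_self qKernel_skew,
        Finset.mul_sum]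
      refine Finset.sum_congr rfl fun j _ => ?_
      have : 0 < l[j] := hpos _ (List.getElem_mem _)
      rw [qKernel, if_neg (by omega), if_pos this, qPair_zero]
      ring
    · rw [List.pairwise_append]
      exact ⟨hl, by simp, by simpa using hpos⟩
    · intro i
      rcases lt_trichotomy i l.length with h | h | h
      · simp [List.getD_eq_getElem?_getD, List.getElem?_append, h]
      · simp [List.getD_eq_getElem?_getD, h]
      · rw [List.getD_eq_default _ _ (by omega), List.getD_eq_default _ _ (by simp; omega)]

/-- The parts of a partition in decreasing order. -/
def partsList (lam : Ptn) : List ℕ := lam.2.parts.sort (· ≥ ·)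

theorem partsList_pos (lam : Ptn) : ∀ i ∈ partsList lam, 0 < i := fun _ hi =>
  lam.2.parts_pos ((Multiset.mem_sort _).1 hi)

theorem length_partsList (lam : Ptn) :
    (partsList lam).length = Multiset.card lam.2.parts := Multiset.length_sort _

theorem partsList_pairwise (lam : Ptn) (h : lam.2.parts.Nodup) :
    (partsList lam).Pairwise (· > ·) := by
  have h1 : (partsList lam).Pairwise (· ≥ ·) := Multiset.pairwise_sort _ _
  have h2 : (partsList lam).Nodup := by
    rw [← Multiset.coe_nodup, partsList, Multiset.sort_eq]; exact h
  exact (h1.and h2).imp fun h => lt_of_le_of_ne h.1 (Ne.symm h.2)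

theorem ptn_ext {lam mu : Ptn} (h : lam.2.parts = mu.2.parts) : lam = mu := by
  obtain ⟨n, lam⟩ := lam
  obtain ⟨k, mu⟩ := mu
  obtain rfl : n = k := by rw [← lam.parts_sum, ← mu.parts_sum, h]
  obtain rfl : lam = mu := Nat.Partition.ext h
  rfl

theorem partsList_injective {lam mu : Ptn} (h : partsList lam = partsList mu) : lam = mu := by
  refine ptn_ext ?_
  rw [← Multiset.sort_eq lam.2.parts (· ≥ ·), ← Multiset.sort_eq mu.2.parts (· ≥ ·)]
  exact congrArg _ h

theorem schurQ_eq (lam : Ptn) (h : lam.2.parts.Nodup) : schurQ lam = schurQList (partsList lam) := by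
  rw [← pfaffian_qMatrix _ (partsList_pairwise lam h) (partsList_pos lam), length_partsList]
  rfl

/-- Functions of `x²` involve only even power sums, which `shift` leaves alone; hence they pass
through the adjoints like scalars. -/
theorem shift_sqVars (f : SymFun) : shift (sqVars f) = Polynomial.C (sqVars f) := by
  have : shift.comp sqVars = (Polynomial.CAlgHom (R := ℂ) (A := SymFun)).comp sqVars := by
    refine MvPolynomial.algHom_ext fun k => ?_
    have h : ¬ Odd ((2 * k : ℕ+) : ℕ) := by simp
    simp only [AlgHom.comp_apply, sqVars, rename_X, shift_X, if_neg h, add_zero]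
    rfl
  exact congrArg (fun φ => φ f) this

theorem bil_schurQ_mul (lam mu : Ptn) (hl : lam.2.parts.Nodup) (hm : mu.2.parts.Nodup)
    (f g : SymFun) : bil (schurQ lam * sqVars f) (schurQ mu * sqVars g) =
      if lam = mu then 2 ^ Multiset.card lam.2.parts * bil (sqVars f) (sqVars g) else 0 := by
  rw [schurQ_eq lam hl, schurQ_eq mu hm, bil_schurQList_mul _ _ (partsList_pairwise lam hl)
    (partsList_pairwise mu hm) (partsList_pos lam) (partsList_pos mu) _ _ (shift_sqVars f)
    (shift_sqVars g), length_partsList]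
  by_cases h : lam = mu
  · rw [if_pos h, if_pos (by rw [h])]
  · rw [if_neg h, if_neg fun h' => h (partsList_injective h')]

/-! ### Reality of the coefficients -/

theorem conj_q (n : ℕ) : conj (q n) = q n := by
  ext m
  rw [conj, coeff_map, coeff_q]
  split_ifs
  · simp [wt, Finsupp.prod, map_ofNat]
  · simp

theorem conj_qPair (r s : ℕ) : conj (qPair r s) = qPair r s := by
  simp [qPair, conj_q, map_ofNat]

theorem conj_schurQ (lam : Ptn) : conj (schurQ lam) = schurQ lam := by
  rw [schurQ, pfaffian_map]
  congr 1
  ext1 i j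
  simp only [Matrix.map_apply, qMatrix]
  split_ifs <;> simp [conj_qPair]

theorem conj_smul (c : ℂ) (f : SymFun) : conj (c • f) = starRingEnd ℂ c • conj f := by
  simp [conj, MvPolynomial.smul_eq_C_mul]

theorem conj_sqVars (f : SymFun) : conj (sqVars f) = sqVars (conj f) := by
  simp [conj, sqVars, MvPolynomial.map_rename]

/-! ### Homogeneity -/

/-- The grading of `Λ`, in which `p_r` has degree `r`. -/
abbrev IsHomog (f : SymFun) (n : ℕ) : Prop :=
  IsWeightedHomogeneous (fun k : ℕ+ => (k : ℕ)) f n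

theorem weight_eq_sum_expParts (m : ℕ+ →₀ ℕ) :
    Finsupp.weight (fun k : ℕ+ => (k : ℕ)) m = (expParts m).sum := by
  rw [sum_expParts, Finsupp.weight_apply]; rfl

theorem isHomog_q (n : ℕ) : IsHomog (q n) n := by
  intro m hm
  rw [coeff_q] at hm
  rw [weight_eq_sum_expParts]
  by_contra h
  exact hm (if_neg fun h' => h h'.1)

theorem isHomog_intCast_mul {f : SymFun} {n : ℕ} (h : IsHomog f n) (c : ℤ) :
    IsHomog ((c : SymFun) * f) n := by
  rw [← zsmul_eq_mul]
  exact (weightedHomogeneousSubmodule ℂ (fun k : ℕ+ => (k : ℕ)) n).smul_of_tower_mem c h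

theorem isHomog_qPair (r s : ℕ) : IsHomog (qPair r s) (r + s) := by
  refine ((isHomog_q r).mul (isHomog_q s)).add ?_
  refine isHomog_intCast_mul (c := 2) (IsWeightedHomogeneous.sum _ _ _ fun i hi => ?_)
  have := isHomog_intCast_mul ((isHomog_q (r + i)).mul (isHomog_q (s - i))) ((-1) ^ i)
  have hi := Finset.mem_Icc.1 hi
  rw [show r + i + (s - i) = r + s by omega] at this
  simpa using this

/-- Each term of the expansion pairs off all the indices, so every index contributes its degree `d
i` once. -/
theorem isHomog_pfaffian (n : ℕ) (A : Matrix (Fin n) (Fin n) SymFun) (d : Fin n → ℕ)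
    (h : ∀ i j, IsHomog (A i j) (d i + d j)) : IsHomog (pfaffian n A) (∑ i, d i) := by
  induction n using Nat.strong_induction_on with
  | _ n ih =>
  match n with
  | 0 => simpa [pfaffian] using isWeightedHomogeneous_one ℂ _
  | 1 => exact isWeightedHomogeneous_zero _ _ _
  | n + 2 =>
    rw [pfaffian_succ_succ]
    refine IsWeightedHomogeneous.sum _ _ _ fun j _ => ?_
    have h1 := ih n (by omega) (A.submatrix (fun i => (j.succAbove i).succ)
      (fun i => (j.succAbove i).succ)) (fun i => d (j.succAbove i).succ) (fun _ _ => h _ _)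
    have h2 := isHomog_intCast_mul ((h 0 j.succ).mul h1) ((-1) ^ (j : ℕ))
    rw [Fin.sum_univ_succ, Fin.sum_univ_succAbove _ j, ← add_assoc, mul_assoc]
    simpa using h2

theorem isHomog_schurQ (lam : Ptn) : IsHomog (schurQ lam) lam.1 := by
  have h : ∑ i : Fin (2 * ((Multiset.card lam.2.parts + 1) / 2)), (partsList lam).getD i 0 =
      lam.1 := by
    have h1 : (partsList lam).sum = lam.1 := by
      rw [← lam.2.parts_sum, ← Multiset.sum_coe, partsList, Multiset.sort_eq]
    refine Eq.trans ?_ h1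
    rw [← length_partsList, Fin.sum_univ_eq_sum_range (fun i => (partsList lam).getD i 0),
      ← Finset.sum_subset (Finset.range_subset_range.2
        (show (partsList lam).length ≤ 2 * (((partsList lam).length + 1) / 2) by omega)),
      ← Fin.sum_univ_eq_sum_range (fun i => (partsList lam).getD i 0)]
    · simp [Fin.sum_univ_getElem]
    · intro i _ hi
      exact List.getD_eq_default _ _ (by simpa using hi)
  rw [← h]
  refine isHomog_pfaffian _ _ _ fun i j => ?_
  simp only [qMatrix]
  split_ifs
  · exact isHomog_qPair _ _
  · have h2 := isHomog_intCast_mul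
      (isHomog_qPair ((partsList lam).getD j 0) ((partsList lam).getD i 0)) (-1)
    rw [add_comm ((partsList lam).getD j 0)] at h2
    rw [Int.cast_neg, Int.cast_one, neg_one_mul] at h2
    exact h2
  · exact isWeightedHomogeneous_zero _ _ _

theorem isHomog_sqVars {f : SymFun} {n : ℕ} (h : IsHomog f n) : IsHomog (sqVars f) (2 * n) := by
  intro m hm
  obtain ⟨u, rfl, hu⟩ := coeff_rename_ne_zero _ _ _ hm
  have := h hu
  rw [Finsupp.weight_apply] at this ⊢
  rw [Finsupp.sum_mapDomain_index (by simp) (by intros; ring), ← this, Finsupp.sum, Finsupp.sum,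
    Finset.mul_sum]
  refine Finset.sum_congr rfl fun k _ => ?_
  simp
  ring

theorem isHomog_powerSum {n : ℕ} (ρ : n.Partition) : IsHomog (powerSum ρ.parts) n := by
  rw [powerSum_eq]
  refine isWeightedHomogeneous_monomial _ _ _ ?_
  rw [weight_eq_sum_expParts, expParts_toExp _ fun i hi => ρ.parts_pos hi, ρ.parts_sum]

theorem isHomog_schurS (lam : Ptn) : IsHomog (schurS lam) lam.1 := by
  refine (weightedHomogeneousSubmodule ℂ (fun k : ℕ+ => (k : ℕ)) lam.1).smul_mem _
    (Submodule.sum_mem _ fun σ _ => Submodule.smul_mem _ _ ?_)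
  rw [mem_weightedHomogeneousSubmodule]
  convert isHomog_powerSum σ.partition
  exact (Fintype.card_fin lam.1).symm

end

/-! ### Tableaux and their row and column groups -/

section Tableau

variable {n : ℕ}

/-- The row and column functions of a bijective filling of a diagram whose columns are initial
segments. -/
structure IsTableau (row col : Fin n → ℕ) : Prop where
  inj : ∀ i j, row i = row j → col i = col j → i = j
  down : ∀ k, ∀ t < row k, ∃ i, row i = t ∧ col i = col k

/-- The first `k` rows can contain at most `min(k, height of j)` entries labelled `j` when labels
are distinct within rows, and a genuine tableau attains this bound. -/
theorem IsTableau.card_fiber_le {row row' s col' : Fin n → ℕ}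
    (T' : IsTableau row' col') (hs : ∀ i j, row i = row j → s i = s j → i = j)
    (hcol : ∀ j, Finset.card {i | s i = j} = Finset.card {i | col' i = j}) (k j : ℕ) :
    Finset.card {i | row i < k ∧ s i = j} ≤ Finset.card {i | row' i < k ∧ col' i = j} := by
  -- If column `j` reaches row `k`, it meets all `k` rows above; otherwise it lies wholly inside the
  -- first `k` rows.
  by_cases h : ∃ i, col' i = j ∧ k ≤ row' i
  · obtain ⟨i, rfl, hi⟩ := h
    have h1 : Finset.card {i' | row i' < k ∧ s i' = col' i} ≤ (Finset.range k).card := by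
      refine Finset.card_le_card_of_injOn row ?_ ?_
      · intro a ha; simp at ha ⊢; exact ha.1
      · intro a ha b hb hab
        simp at ha hb
        exact hs a b hab (ha.2.trans hb.2.symm)
    refine h1.trans ?_
    refine (Finset.card_le_card (t := Finset.image row'
      {i' | row' i' < k ∧ col' i' = col' i}) ?_).trans Finset.card_image_le
    intro t ht
    obtain ⟨i', h1, h2⟩ := T'.down i t (by simp at ht; omega)
    simp at ht ⊢
    exact ⟨i', ⟨by omega, h2⟩, h1⟩
  · push Not at h
    calc Finset.card {i | row i < k ∧ s i = j} ≤ Finset.card {i | s i = j} :=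
          Finset.card_le_card fun i hi => by simp at hi ⊢; exact hi.2
      _ = Finset.card {i | col' i = j} := hcol j
      _ ≤ _ := Finset.card_le_card fun i hi => by simp at hi ⊢; exact ⟨h i hi, hi⟩

theorem card_eq_sum_fibers (p : Fin n → Prop) [DecidablePred p] (s : Fin n → ℕ) (N : ℕ)
    (hN : ∀ i, s i < N) : Finset.card {i | p i} =
      ∑ j ∈ Finset.range N, Finset.card {i | p i ∧ s i = j} := by
  rw [Finset.card_eq_sum_card_fiberwise (f := s) (t := Finset.range N)]
  · simp only [Finset.filter_filter]
  · intro i _; simpa using hN i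

theorem exists_bound (s : Fin n → ℕ) : ∃ N, ∀ i, s i < N :=
  ⟨∑ i, s i + 1, fun i => Nat.lt_succ_of_le
    (Finset.single_le_sum (f := s) (fun _ _ => Nat.zero_le _) (Finset.mem_univ i))⟩

theorem card_fiber_comp_perm (g : Equiv.Perm (Fin n)) (col : Fin n → ℕ) (j : ℕ) :
    Finset.card {i | col (g i) = j} = Finset.card {i | col i = j} := by
  refine Finset.card_bij (fun i _ => g i) ?_ ?_ ?_
  · intro i hi; simpa using hi
  · intro a _ b _ h; exact g.injective h
  · intro b hb; exact ⟨g⁻¹ b, by simpa using hb, by simp⟩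

/-- Two entries in the same row of the first tableau and in the same column of the second,
whose entries are permuted by `g`. -/
def HasPair (row col' : Fin n → ℕ) (g : Equiv.Perm (Fin n)) : Prop :=
  ∃ i j, i ≠ j ∧ row i = row j ∧ col' (g⁻¹ i) = col' (g⁻¹ j)

theorem IsTableau.dominance {row row' col' : Fin n → ℕ}
    (T' : IsTableau row' col') (g : Equiv.Perm (Fin n)) (h : ¬ HasPair row col' g) (k : ℕ) :
    Finset.card {i | row i < k} ≤ Finset.card {i | row' i < k} := by
  obtain ⟨N, hN⟩ := exists_bound (fun i => col' (g⁻¹ i))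
  have hN' : ∀ i, col' i < N := fun i => by simpa using hN (g i)
  rw [card_eq_sum_fibers (fun i => row i < k) _ N hN,
    card_eq_sum_fibers (fun i => row' i < k) _ N hN']
  refine Finset.sum_le_sum fun j _ => ?_
  refine T'.card_fiber_le ?_ (card_fiber_comp_perm g⁻¹ col') k j
  intro a b h1 h2
  by_contra hne
  exact h ⟨a, b, hne, h1, h2⟩

/-- The tableau and its image under `g` have the same shape, so all the inequalities of
`card_fiber_le` are equalities. Hence each row shows the same column labels for both, and a row
permutation aligns them. -/
theorem IsTableau.exists_mul {row col : Fin n → ℕ} (T : IsTableau row col)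
    (g : Equiv.Perm (Fin n)) (h : ¬ HasPair row col g) :
    ∃ p q : Equiv.Perm (Fin n), (∀ k, row (p k) = row k) ∧ (∀ k, col (q k) = col k) ∧
      g = p * q := by
  set s : Fin n → ℕ := fun i => col (g⁻¹ i) with hs
  have hinj : ∀ i j, row i = row j → s i = s j → i = j := by
    intro a b h1 h2
    by_contra hne
    exact h ⟨a, b, hne, h1, h2⟩
  obtain ⟨N, hN⟩ := exists_bound s
  have hN' : ∀ i, col i < N := fun i => by simpa [hs] using hN (g i)
  have hle := fun k j => T.card_fiber_le hinj (card_fiber_comp_perm g⁻¹ col) k j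
  have heq : ∀ k j, j < N → Finset.card {i | row i < k ∧ s i = j} =
      Finset.card {i | row i < k ∧ col i = j} := by
    intro k j hj
    have h1 := card_eq_sum_fibers (fun i => row i < k) s N hN
    rw [card_eq_sum_fibers (fun i => row i < k) col N hN'] at h1
    exact (Finset.sum_eq_sum_iff_of_le (fun j _ => hle k j)).1 h1.symm j (by simpa using hj)
  have hex : ∀ i, ∃ i', row i' = row i ∧ col i' = s i := by
    intro i
    by_contra hcon
    push Not at hcon
    have h1 := heq (row i) (s i) (hN i)
    have h2 := heq (row i + 1) (s i) (hN i)
    have h3 : Finset.card {i' | row i' < row i + 1 ∧ col i' = s i} =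
        Finset.card {i' | row i' < row i ∧ col i' = s i} := by
      congr 1; ext i'
      simp only [Finset.mem_filter, Finset.mem_univ, true_and]
      refine ⟨fun ⟨h1, h2⟩ => ⟨lt_of_le_of_ne (Nat.lt_succ_iff.1 h1) fun h => hcon i' h h2, h2⟩,
        fun h => ⟨by omega, h.2⟩⟩
    have h4 : Finset.card {i' | row i' < row i ∧ s i' = s i} <
        Finset.card {i' | row i' < row i + 1 ∧ s i' = s i} := by
      refine Finset.card_lt_card (Finset.ssubset_iff_of_subset ?_ |>.2 ⟨i, by simp, by simp⟩)
      intro i' hi'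
      simp at hi' ⊢
      exact ⟨by omega, hi'.2⟩
    omega
  choose φ hφ1 hφ2 using hex
  have hφ : Function.Bijective φ := by
    rw [← Finite.injective_iff_bijective]
    intro a b hab
    exact hinj a b (by rw [← hφ1, hab, hφ1]) (by rw [← hφ2, hab, hφ2])
  set P := Equiv.ofBijective φ hφ
  have hP : ∀ i, P i = φ i := fun i => rfl
  -- `P` moves each entry within its row to the column it occupies in the permuted tableau, so `P`
  -- preserves rows and `P * g` preserves columns.
  refine ⟨P⁻¹, P * g, fun k => ?_, fun k => ?_, by group⟩
  · rw [← hφ1 (P⁻¹ k), ← hP]; simp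
  · rw [Equiv.Perm.mul_apply, hP, hφ2]; simp [hs]

end Tableau

/-! ### Symmetrizers in the group algebra -/

section Symmetrizer

open Classical MonoidAlgebra

variable {n : ℕ}

/-- The sum of the permutations preserving a function. -/
def symmetrizer (f : Fin n → ℕ) : MonoidAlgebra ℂ (Equiv.Perm (Fin n)) :=
  ∑ σ : Equiv.Perm (Fin n) with ∀ k, f (σ k) = f k, MonoidAlgebra.of ℂ _ σ

/-- The signed sum of the permutations preserving a function. -/
def antisymmetrizer (f : Fin n → ℕ) : MonoidAlgebra ℂ (Equiv.Perm (Fin n)) :=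
  ∑ σ : Equiv.Perm (Fin n) with ∀ k, f (σ k) = f k,
    ((Equiv.Perm.sign σ : ℤ) : ℂ) • MonoidAlgebra.of ℂ _ σ

theorem coeff_symmetrizer (f : Fin n → ℕ) (g : Equiv.Perm (Fin n)) :
    (symmetrizer f).coeff g = if ∀ k, f (g k) = f k then 1 else 0 := by
  rw [symmetrizer, coeff_sum, Finsupp.finsetSum_apply]
  simp [Finsupp.single_apply]

theorem coeff_antisymmetrizer (f : Fin n → ℕ) (g : Equiv.Perm (Fin n)) :
    (antisymmetrizer f).coeff g =
      if ∀ k, f (g k) = f k then ((Equiv.Perm.sign g : ℤ) : ℂ) else 0 := by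
  rw [antisymmetrizer, coeff_sum, Finsupp.finsetSum_apply]
  simp [Finsupp.single_apply]

theorem preserves_inv {f : Fin n → ℕ} {σ : Equiv.Perm (Fin n)} (h : ∀ k, f (σ k) = f k) (k : Fin n) :
    f (σ⁻¹ k) = f k := by
  rw [← h (σ⁻¹ k)]; simp

theorem preserves_mul_iff {f : Fin n → ℕ} {σ : Equiv.Perm (Fin n)} (h : ∀ k, f (σ k) = f k)
    (g : Equiv.Perm (Fin n)) : (∀ k, f ((σ * g) k) = f k) ↔ ∀ k, f (g k) = f k := by
  simp [h]

theorem preserves_mul_iff' {f : Fin n → ℕ} {σ : Equiv.Perm (Fin n)} (h : ∀ k, f (σ k) = f k)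
    (g : Equiv.Perm (Fin n)) : (∀ k, f ((g * σ) k) = f k) ↔ ∀ k, f (g k) = f k := by
  refine ⟨fun H k => ?_, fun H k => ?_⟩
  · have := H (σ⁻¹ k)
    simp at this
    exact this.trans (preserves_inv h k)
  · simp [H, h]

theorem of_mul_symmetrizer {f : Fin n → ℕ} {σ : Equiv.Perm (Fin n)} (h : ∀ k, f (σ k) = f k) :
    of ℂ _ σ * symmetrizer f = symmetrizer f := by
  ext g
  rw [of_apply, coeff_single_mul_apply, one_mul, coeff_symmetrizer, coeff_symmetrizer]
  simp only [preserves_mul_iff (preserves_inv h)]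

theorem symmetrizer_mul_of {f : Fin n → ℕ} {σ : Equiv.Perm (Fin n)} (h : ∀ k, f (σ k) = f k) :
    symmetrizer f * of ℂ _ σ = symmetrizer f := by
  ext g
  rw [of_apply, coeff_mul_single_apply, mul_one, coeff_symmetrizer, coeff_symmetrizer]
  simp only [preserves_mul_iff' (preserves_inv h)]

theorem of_mul_antisymmetrizer {f : Fin n → ℕ} {σ : Equiv.Perm (Fin n)}
    (h : ∀ k, f (σ k) = f k) :
    of ℂ _ σ * antisymmetrizer f = ((Equiv.Perm.sign σ : ℤ) : ℂ) • antisymmetrizer f := by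
  ext g
  rw [of_apply, coeff_single_mul_apply, one_mul, coeff_smul_apply, coeff_antisymmetrizer,
    coeff_antisymmetrizer]
  simp only [preserves_mul_iff (preserves_inv h)]
  split_ifs <;> simp

theorem antisymmetrizer_mul_of {f : Fin n → ℕ} {σ : Equiv.Perm (Fin n)}
    (h : ∀ k, f (σ k) = f k) :
    antisymmetrizer f * of ℂ _ σ = ((Equiv.Perm.sign σ : ℤ) : ℂ) • antisymmetrizer f := by
  ext g
  rw [of_apply, coeff_mul_single_apply, mul_one, coeff_smul_apply, coeff_antisymmetrizer,
    coeff_antisymmetrizer]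
  simp only [preserves_mul_iff' (preserves_inv h)]
  split_ifs <;> simp [mul_comm]

theorem swap_preserves {f : Fin n → ℕ} {i j : Fin n} (h : f i = f j) (k : Fin n) :
    f (Equiv.swap i j k) = f k := by
  rcases eq_or_ne k i with rfl | hi
  · simp [h]
  rcases eq_or_ne k j with rfl | hj
  · simp [h]
  rw [Equiv.swap_apply_of_ne_of_ne hi hj]

theorem swap_mul_eq (g : Equiv.Perm (Fin n)) (i j : Fin n) :
    Equiv.swap i j * g = g * Equiv.swap (g⁻¹ i) (g⁻¹ j) := by
  rw [Equiv.swap_mul_eq_mul_swap]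

theorem eq_zero_of_eq_neg {x : MonoidAlgebra ℂ (Equiv.Perm (Fin n))} (h : x = -x) : x = 0 := by
  ext g
  have := congrArg (fun y => y.coeff g) h
  simpa [self_eq_neg] using this

theorem linear_of_forall {N : Type*} [AddCommMonoid N] [Module ℂ N]
    {φ ψ : MonoidAlgebra ℂ (Equiv.Perm (Fin n)) →ₗ[ℂ] N} (h : ∀ g, φ (of ℂ _ g) = ψ (of ℂ _ g)) :
    φ = ψ :=
  (MonoidAlgebra.basis _ ℂ).ext fun g => by simpa using h g

/-- The transposition of the pair is absorbed by the symmetrizer on the left; carried past `g`, it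
changes the sign of the antisymmetrizer on the right. -/
theorem symmetrizer_mul_mul_antisymmetrizer (row col' : Fin n → ℕ)
    (h : ∀ g, HasPair row col' g) (x : MonoidAlgebra ℂ (Equiv.Perm (Fin n))) :
    symmetrizer row * x * antisymmetrizer col' = 0 := by
  have : (LinearMap.mulRight ℂ (antisymmetrizer col')) ∘ₗ
      (LinearMap.mulLeft ℂ (symmetrizer row)) = 0 := by
    refine linear_of_forall fun g => ?_
    obtain ⟨i, j, hij, h1, h2⟩ := h g
    simp only [LinearMap.comp_apply, LinearMap.mulRight_apply, LinearMap.mulLeft_apply,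
      LinearMap.zero_apply]
    refine eq_zero_of_eq_neg ?_
    conv_lhs => rw [← symmetrizer_mul_of (swap_preserves h1), mul_assoc (symmetrizer row),
      ← map_mul, swap_mul_eq, map_mul, ← mul_assoc, mul_assoc,
      of_mul_antisymmetrizer (swap_preserves h2)]
    rw [Equiv.Perm.sign_swap (by simpa using hij)]
    simp
  exact congrArg (fun φ => φ x) this

theorem antisymmetrizer_mul_mul_symmetrizer (row col' : Fin n → ℕ)
    (h : ∀ g, HasPair row col' g) (x : MonoidAlgebra ℂ (Equiv.Perm (Fin n))) :
    antisymmetrizer col' * x * symmetrizer row = 0 := by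
  have : (LinearMap.mulRight ℂ (symmetrizer row)) ∘ₗ
      (LinearMap.mulLeft ℂ (antisymmetrizer col')) = 0 := by
    refine linear_of_forall fun g => ?_
    obtain ⟨i, j, hij, h1, h2⟩ := h g⁻¹
    simp only [LinearMap.comp_apply, LinearMap.mulRight_apply, LinearMap.mulLeft_apply,
      LinearMap.zero_apply]
    refine eq_zero_of_eq_neg ?_
    rw [inv_inv] at h2
    have e : Equiv.swap (g i) (g j) * g = g * Equiv.swap i j := by
      rw [swap_mul_eq]; simp
    conv_lhs => rw [← of_mul_symmetrizer (swap_preserves h1), ← mul_assoc, mul_assoc _ (of ℂ _ g),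
      ← map_mul, ← e, map_mul, ← mul_assoc, antisymmetrizer_mul_of (swap_preserves h2)]
    rw [Equiv.Perm.sign_swap (by simpa using hij)]
    simp
  exact congrArg (fun φ => φ x) this

/-- The Young symmetrizer of a tableau. -/
def young (row col : Fin n → ℕ) : MonoidAlgebra ℂ (Equiv.Perm (Fin n)) :=
  symmetrizer row * antisymmetrizer col

variable {row col : Fin n → ℕ}

theorem young_coeff_one (T : IsTableau row col) : (young row col).coeff 1 = 1 := by
  rw [young, symmetrizer, Finset.sum_mul, coeff_sum, Finsupp.finsetSum_apply]
  rw [Finset.sum_eq_single_of_mem 1 (by simp)]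
  · rw [of_apply, coeff_single_mul_apply, coeff_antisymmetrizer]; simp
  · intro σ hσ hne
    rw [of_apply, coeff_single_mul_apply, coeff_antisymmetrizer, if_neg, mul_zero]
    intro h
    simp only [Finset.mem_filter, Finset.mem_univ, true_and] at hσ
    refine hne (Equiv.ext fun k => ?_)
    rw [mul_one] at h
    have h2 : col (σ k) = col k := by rw [← h (σ k)]; simp
    exact T.inj _ _ (hσ k) h2

/-- The symmetry determines `z` on products `p q` of a row and a column permutation from its value
at `1`. Any other `g` has a pair, whose transposition forces `z(g) = -z(g)`. -/
theorem eq_zero_of_invariant (T : IsTableau row col)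
    (z : MonoidAlgebra ℂ (Equiv.Perm (Fin n)))
    (h1 : ∀ σ : Equiv.Perm (Fin n), (∀ k, row (σ k) = row k) → of ℂ _ σ * z = z)
    (h2 : ∀ σ : Equiv.Perm (Fin n), (∀ k, col (σ k) = col k) →
      z * of ℂ _ σ = ((Equiv.Perm.sign σ : ℤ) : ℂ) • z)
    (h0 : z.coeff 1 = 0) : z = 0 := by
  have e1 : ∀ σ : Equiv.Perm (Fin n), (∀ k, row (σ k) = row k) → ∀ g,
      z.coeff (σ * g) = z.coeff g := by
    intro σ hσ g
    conv_rhs => rw [← h1 σ⁻¹ (preserves_inv hσ)]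
    simp [of_apply, coeff_single_mul_apply]
  have e2 : ∀ σ : Equiv.Perm (Fin n), (∀ k, col (σ k) = col k) → ∀ g,
      z.coeff (g * σ) = ((Equiv.Perm.sign σ : ℤ) : ℂ) * z.coeff g := by
    intro σ hσ g
    have := congrArg (fun y => y.coeff g) (h2 σ⁻¹ (preserves_inv hσ))
    simpa [of_apply, coeff_mul_single_apply] using this
  ext g
  by_cases hg : HasPair row col g
  · obtain ⟨i, j, hij, hr, hc⟩ := hg
    have := e1 _ (swap_preserves hr) g
    rw [swap_mul_eq, e2 _ (swap_preserves hc), Equiv.Perm.sign_swap (by simpa using hij)] at this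
    simpa [neg_eq_self] using this
  · obtain ⟨p, q, hp, hq, rfl⟩ := T.exists_mul g hg
    rw [e1 p hp, ← one_mul q, e2 q hq, h0]
    simp

theorem young_mul_mul_young (T : IsTableau row col)
    (x : MonoidAlgebra ℂ (Equiv.Perm (Fin n))) :
    young row col * x * young row col =
      (young row col * x * young row col).coeff 1 • young row col := by
  rw [← sub_eq_zero]
  refine eq_zero_of_invariant T _ ?_ ?_ ?_
  · intro σ hσ
    rw [mul_sub, mul_smul_comm]
    simp only [young, ← mul_assoc, of_mul_symmetrizer hσ]
  · intro σ hσ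
    rw [sub_mul, smul_mul_assoc]
    simp only [young, mul_assoc, antisymmetrizer_mul_of hσ, mul_smul_comm, smul_sub]
    rw [smul_comm]
  · rw [coeff_sub, Finsupp.sub_apply, coeff_smul_apply, young_coeff_one T]
    simp

end Symmetrizer

/-! ### The characters of the Specht modules -/

section Character

open MonoidAlgebra

variable {n : ℕ}

theorem coeff_mul_one_comm (x y : MonoidAlgebra ℂ (Equiv.Perm (Fin n))) :
    (x * y).coeff 1 = (y * x).coeff 1 := by
  have : (MonoidAlgebra.basis (Equiv.Perm (Fin n)) ℂ).coord 1 ∘ₗ LinearMap.mulRight ℂ y =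
      (MonoidAlgebra.basis (Equiv.Perm (Fin n)) ℂ).coord 1 ∘ₗ LinearMap.mulLeft ℂ y := by
    refine linear_of_forall fun g => ?_
    change (of ℂ _ g * y).coeff 1 = (y * of ℂ _ g).coeff 1
    rw [of_apply, coeff_single_mul_apply, coeff_mul_single_apply]
    simp
  exact congrArg (fun φ => φ x) this

theorem coeff_mul_eq_sum (x y : MonoidAlgebra ℂ (Equiv.Perm (Fin n))) (h : Equiv.Perm (Fin n)) :
    (x * y).coeff h = ∑ g, x.coeff g * y.coeff (g⁻¹ * h) := by
  rw [coeff_mul_apply_left]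
  exact Finsupp.sum_fintype _ _ (by simp)

/-- The diagonal entry at `g` of the map `x ↦ σ x c` in the group basis is the coefficient of `c` at
`g⁻¹ σ⁻¹ g`. -/
theorem trace_mul_mul (σ : Equiv.Perm (Fin n)) (c : MonoidAlgebra ℂ (Equiv.Perm (Fin n))) :
    LinearMap.trace ℂ _ (LinearMap.mulRight ℂ c ∘ₗ LinearMap.mulLeft ℂ (of ℂ _ σ)) =
      ∑ g, c.coeff (g⁻¹ * σ⁻¹ * g) := by
  classical
  rw [LinearMap.trace_eq_matrix_trace ℂ (MonoidAlgebra.basis (Equiv.Perm (Fin n)) ℂ),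
    Matrix.trace]
  refine Finset.sum_congr rfl fun g _ => ?_
  rw [Matrix.diag_apply, LinearMap.toMatrix_apply, basis_apply]
  change (of ℂ _ σ * single g 1 * c).coeff g = _
  rw [of_apply, single_mul_single, coeff_single_mul_apply]
  simp [mul_assoc]

variable {row col : Fin n → ℕ}

/-- The scalar `k` with `c² = k c` for the Young symmetrizer `c`. -/
def youngScalar (row col : Fin n → ℕ) : ℂ := (young row col * young row col).coeff 1

theorem young_sq (T : IsTableau row col) :
    young row col * young row col = youngScalar row col • young row col := by
  have := young_mul_mul_young T 1
  rwa [mul_one] at this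

/-- If the square of the symmetrizer `c` were zero, right multiplication by `c` would be nilpotent
and have trace zero; but its trace is `n!` times the coefficient `1` of the identity in `c`. -/
theorem youngScalar_ne_zero (T : IsTableau row col) : youngScalar row col ≠ 0 := by
  intro h0
  have hsq : young row col * young row col = 0 := by rw [young_sq T, h0, zero_smul]
  have h1 := trace_mul_mul (1 : Equiv.Perm (Fin n)) (young row col)
  have hnil : IsNilpotent (LinearMap.mulRight ℂ (young row col) ∘ₗ
      LinearMap.mulLeft ℂ (of ℂ _ (1 : Equiv.Perm (Fin n)))) := by
    refine ⟨2, ?_⟩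
    refine LinearMap.ext fun x => ?_
    rw [pow_two, Module.End.mul_apply]
    simp only [LinearMap.comp_apply, LinearMap.mulLeft_apply, LinearMap.mulRight_apply, map_one,
      one_mul, mul_assoc, hsq, mul_zero, LinearMap.zero_apply]
  have h2 := (LinearMap.isNilpotent_trace_of_isNilpotent hnil).eq_zero
  rw [h2] at h1
  simp [young_coeff_one T] at h1
  exact Fintype.card_ne_zero (α := Equiv.Perm (Fin n)) (by exact_mod_cast h1.symm)

/-- The map `x ↦ σ x c` factors through the left ideal generated by `c`, on which it equals the
scalar times the action of `σ`, because `c² = k c`. The trace is unchanged when the two factors are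
exchanged. -/
theorem youngScalar_mul_trace (T : IsTableau row col) (σ : Equiv.Perm (Fin n)) :
    youngScalar row col * (Representation.ofModule' (k := ℂ) (G := Equiv.Perm (Fin n))
      (Ideal.span {young row col} : Ideal (MonoidAlgebra ℂ (Equiv.Perm (Fin n))))).character σ =
      ∑ g, (young row col).coeff (g⁻¹ * σ⁻¹ * g) := by
  set c := young row col
  set I : Ideal (MonoidAlgebra ℂ (Equiv.Perm (Fin n))) := Ideal.span {c}
  let incl : I →ₗ[ℂ] MonoidAlgebra ℂ (Equiv.Perm (Fin n)) :=
    { toFun := fun x => x, map_add' := fun _ _ => rfl, map_smul' := fun _ _ => rfl }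
  let T' : MonoidAlgebra ℂ (Equiv.Perm (Fin n)) →ₗ[ℂ] I :=
    { toFun := fun x => ⟨of ℂ _ σ * x * c, Ideal.mul_mem_left _ _ (Ideal.subset_span rfl)⟩
      map_add' := fun x y => Subtype.ext (by simp [mul_add, add_mul])
      map_smul' := fun r x => Subtype.ext (by simp) }
  have hfin : FiniteDimensional ℂ (MonoidAlgebra ℂ (Equiv.Perm (Fin n))) :=
    Module.Finite.of_basis (MonoidAlgebra.basis (Equiv.Perm (Fin n)) ℂ)
  have hfin' : FiniteDimensional ℂ I :=
    FiniteDimensional.of_injective incl Subtype.val_injective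
  have h1 : incl ∘ₗ T' = LinearMap.mulRight ℂ c ∘ₗ LinearMap.mulLeft ℂ (of ℂ _ σ) := rfl
  have h2 : T' ∘ₗ incl = youngScalar row col •
      Representation.ofModule' (k := ℂ) (G := Equiv.Perm (Fin n)) I σ := by
    ext1 x
    refine Subtype.ext ?_
    obtain ⟨y, hy⟩ := Ideal.mem_span_singleton'.1 x.2
    change of ℂ _ σ * (x : MonoidAlgebra ℂ (Equiv.Perm (Fin n))) * c =
      youngScalar row col • (of ℂ _ σ * (x : MonoidAlgebra ℂ (Equiv.Perm (Fin n))))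
    rw [← hy, mul_assoc, mul_assoc, young_sq T, mul_smul_comm, mul_smul_comm]
  rw [← trace_mul_mul, ← h1, LinearMap.trace_comp_comm', h2, map_smul]
  rfl

/-! ### Sums entering the orthogonality relations -/

theorem sum_coeff_conj_mul (c d : MonoidAlgebra ℂ (Equiv.Perm (Fin n))) :
    ∑ σ : Equiv.Perm (Fin n), (∑ g, c.coeff (g⁻¹ * σ⁻¹ * g)) * (∑ h, d.coeff (h⁻¹ * σ * h)) =
      (n.factorial : ℂ) * ∑ a, (c * of ℂ _ a * d).coeff a := by
  have e : ∀ a : Equiv.Perm (Fin n), (c * of ℂ _ a * d).coeff a =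
      ∑ s, c.coeff s⁻¹ * d.coeff (a⁻¹ * s * a) := by
    intro a
    rw [coeff_mul_eq_sum, ← Equiv.sum_comp ((Equiv.inv _).trans (Equiv.mulRight a))]
    refine Finset.sum_congr rfl fun s _ => ?_
    simp [of_apply, coeff_mul_single_apply]
  have e2 : ∀ g : Equiv.Perm (Fin n), ∑ σ : Equiv.Perm (Fin n),
      c.coeff (g⁻¹ * σ⁻¹ * g) * (∑ h, d.coeff (h⁻¹ * σ * h)) =
      ∑ a, (c * of ℂ _ a * d).coeff a := by
    intro g
    simp only [e]
    rw [Finset.sum_comm, ← Equiv.sum_comp (MulAut.conj g).toEquiv]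
    refine Finset.sum_congr rfl fun s _ => ?_
    rw [Finset.mul_sum, ← Equiv.sum_comp (Equiv.mulLeft g)]
    refine Finset.sum_congr rfl fun a _ => ?_
    simp [mul_assoc]
  simp only [Finset.sum_mul]
  rw [Finset.sum_comm, Finset.sum_congr rfl fun g _ => e2 g]
  simp [Fintype.card_perm]

/-- Let `k` be the scalar. As `c a c` is a multiple of `c`, cyclicity of the coefficient at `1`
gives `(c a c)(1) = (a c²)(1) = k c(a⁻¹)`. Then `∑ c(a) c(a⁻¹) = c²(1) = k`. -/
theorem sum_young_coeff (T : IsTableau row col) :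
    ∑ a, (young row col * of ℂ _ a * young row col).coeff a = youngScalar row col ^ 2 := by
  have h : ∀ a : Equiv.Perm (Fin n), (young row col * of ℂ _ a * young row col).coeff a =
      youngScalar row col * ((young row col).coeff a * (young row col).coeff (a⁻¹ * 1)) := by
    intro a
    rw [young_mul_mul_young T, coeff_smul_apply, mul_assoc, coeff_mul_one_comm, mul_assoc,
      young_sq T, mul_smul_comm, coeff_smul_apply, of_apply, coeff_single_mul_apply]
    simp
    ring
  rw [Finset.sum_congr rfl fun a _ => h a, ← Finset.mul_sum, ← coeff_mul_eq_sum, pow_two]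
  rfl

end Character

/-! ### The tableau of a partition -/

theorem cell_spec (l : List ℕ) (k : ℕ) (h : k < l.sum) :
    (cell l k).2 < l.getD (cell l k).1 0 := by
  induction l generalizing k with
  | nil => simp at h
  | cons a l ih =>
    rw [cell]
    split_ifs with hk
    · simpa using hk
    · have := ih (k - a) (by simp at h; omega)
      simpa using this

theorem cell_injOn (l : List ℕ) (k k' : ℕ) (h : k < l.sum) (h' : k' < l.sum)
    (he : cell l k = cell l k') : k = k' := by
  induction l generalizing k k' with
  | nil => simp at h
  | cons a l ih =>
    rw [cell, cell] at he
    simp at h h'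
    split_ifs at he with h1 h2 h2
    · simpa using he
    · simp at he
    · simp at he
    · simp only [Prod.mk.injEq, Nat.add_right_cancel_iff] at he
      have := ih (k - a) (k' - a) (by omega) (by omega) (Prod.ext he.1 he.2)
      omega

theorem cell_surj (l : List ℕ) (i j : ℕ) (h : j < l.getD i 0) :
    ∃ k < l.sum, cell l k = (i, j) := by
  induction l generalizing i with
  | nil => simp at h
  | cons a l ih =>
    cases i with
    | zero =>
      simp at h
      exact ⟨j, by simp; omega, by rw [cell, if_pos h]⟩
    | succ i =>
      obtain ⟨k, hk, e⟩ := ih i (by simpa using h)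
      refine ⟨a + k, by simp; omega, ?_⟩
      rw [cell, if_neg (by omega)]
      simp [e]

section

variable {n : ℕ} (lam : n.Partition)

theorem sum_sort : (lam.parts.sort (· ≥ ·)).sum = n := by
  rw [← Multiset.sum_coe, Multiset.sort_eq, lam.parts_sum]

theorem tableau_isTableau :
    IsTableau (fun k => (tableau lam k).1) (fun k => (tableau lam k).2) where
  inj i j h1 h2 := Fin.ext (cell_injOn _ _ _ (by rw [sum_sort]; exact i.2)
    (by rw [sum_sort]; exact j.2) (Prod.ext h1 h2))
  down k t ht := by
    have h1 := cell_spec (lam.parts.sort (· ≥ ·)) k (by rw [sum_sort]; exact k.2)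
    have h2 : (lam.parts.sort (· ≥ ·)).getD (tableau lam k).1 0 ≤
        (lam.parts.sort (· ≥ ·)).getD t 0 := by
      have hs : (lam.parts.sort (· ≥ ·)).Pairwise (· ≥ ·) := Multiset.pairwise_sort _ _
      by_cases hlen : (tableau lam k).1 < (lam.parts.sort (· ≥ ·)).length
      · rw [List.getD_eq_getElem _ _ hlen, List.getD_eq_getElem _ _ (ht.trans hlen)]
        exact List.pairwise_iff_getElem.1 hs _ _ _ _ ht
      · rw [List.getD_eq_default _ _ (by omega)]; exact Nat.zero_le _
    obtain ⟨i, hi, e⟩ := cell_surj _ t (tableau lam k).2 (lt_of_lt_of_le h1 h2)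
    rw [sum_sort] at hi
    exact ⟨⟨i, hi⟩, by simp [tableau, e], by simp [tableau, e]⟩

theorem card_row_eq (i : ℕ) : Finset.card {k | (tableau lam k).1 = i} =
    (lam.parts.sort (· ≥ ·)).getD i 0 := by
  conv_rhs => rw [← Finset.card_range ((lam.parts.sort (· ≥ ·)).getD i 0)]
  refine Finset.card_bij (fun k _ => (tableau lam k).2) ?_ ?_ ?_
  · intro k hk
    simp only [Finset.mem_filter, Finset.mem_univ, true_and] at hk
    rw [← hk, Finset.mem_range]
    exact cell_spec _ _ (by rw [sum_sort]; exact k.2)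
  · intro a ha b hb h
    simp only [Finset.mem_filter, Finset.mem_univ, true_and] at ha hb
    exact (tableau_isTableau lam).inj a b (ha.trans hb.symm) h
  · intro j hj
    obtain ⟨k, hk, e⟩ := cell_surj _ i j (Finset.mem_range.1 hj)
    rw [sum_sort] at hk
    exact ⟨⟨k, hk⟩, by simp [tableau, e], by simp [tableau, e]⟩

theorem eq_of_card_row_lt {lam mu : n.Partition}
    (h : ∀ k, Finset.card {i | (tableau lam i).1 < k} = Finset.card {i | (tableau mu i).1 < k}) :
    lam = mu := by
  have hsplit : ∀ (nu : n.Partition) (k : ℕ), Finset.card {i | (tableau nu i).1 < k + 1} =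
      Finset.card {i | (tableau nu i).1 < k} + (nu.parts.sort (· ≥ ·)).getD k 0 := by
    intro nu k
    rw [← card_row_eq, ← Finset.card_union_of_disjoint]
    · congr 1; ext i; simp; omega
    · rw [Finset.disjoint_filter]; intro i _ h1 h2; omega
  have hget : ∀ k, (lam.parts.sort (· ≥ ·)).getD k 0 = (mu.parts.sort (· ≥ ·)).getD k 0 := by
    intro k
    have h1 := h (k + 1)
    rw [hsplit, hsplit, h k] at h1
    omega
  have hpos : ∀ (nu : n.Partition) (k : ℕ),
      k < (nu.parts.sort (· ≥ ·)).length ↔ 0 < (nu.parts.sort (· ≥ ·)).getD k 0 := by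
    intro nu k
    constructor
    · intro hk
      rw [List.getD_eq_getElem _ _ hk]
      exact nu.parts_pos ((Multiset.mem_sort _).1 (List.getElem_mem hk))
    · intro hk
      by_contra hn
      rw [List.getD_eq_default _ _ (by omega)] at hk
      omega
  have hlist : lam.parts.sort (· ≥ ·) = mu.parts.sort (· ≥ ·) := by
    refine List.ext_getElem ?_ ?_
    · refine le_antisymm ?_ ?_
      · by_contra! hcon
        have := (hpos _ _).1 hcon
        rw [hget] at this
        exact lt_irrefl _ ((hpos _ _).2 this)
      · by_contra! hcon
        have := (hpos _ _).1 hcon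
        rw [← hget] at this
        exact lt_irrefl _ ((hpos _ _).2 this)
    · intro i h1 h2
      rw [← List.getD_eq_getElem _ 0 h1, ← List.getD_eq_getElem _ 0 h2, hget]
  refine Nat.Partition.ext ?_
  rw [← Multiset.sort_eq lam.parts (· ≥ ·), hlist, Multiset.sort_eq]

/-- The Young symmetrizer of a partition. -/
def youngOf : MonoidAlgebra ℂ (Equiv.Perm (Fin n)) :=
  young (fun k => (tableau lam k).1) (fun k => (tableau lam k).2)

/-- If neither vanishing criterion applies, the two shapes dominate each other and therefore
coincide. -/
theorem youngOf_mul_mul_youngOf {lam mu : n.Partition} (h : lam ≠ mu)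
    (x : MonoidAlgebra ℂ (Equiv.Perm (Fin n))) : youngOf lam * x * youngOf mu = 0 := by
  by_cases h1 : ∀ g, HasPair (fun k => (tableau lam k).1) (fun k => (tableau mu k).2) g
  · have := symmetrizer_mul_mul_antisymmetrizer _ _ h1
      (antisymmetrizer (fun k => (tableau lam k).2) * x * symmetrizer (fun k => (tableau mu k).1))
    simpa only [youngOf, young, mul_assoc] using this
  by_cases h2 : ∀ g, HasPair (fun k => (tableau mu k).1) (fun k => (tableau lam k).2) g
  · have := antisymmetrizer_mul_mul_symmetrizer _ _ h2 x
    have e : youngOf lam * x * youngOf mu = symmetrizer (fun k => (tableau lam k).1) *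
        (antisymmetrizer (fun k => (tableau lam k).2) * x *
          symmetrizer (fun k => (tableau mu k).1)) *
        antisymmetrizer (fun k => (tableau mu k).2) := by
      simp only [youngOf, young, mul_assoc]
    rw [e, this]; simp
  push Not at h1 h2
  obtain ⟨g1, h1⟩ := h1
  obtain ⟨g2, h2⟩ := h2
  exact absurd (eq_of_card_row_lt fun k => le_antisymm
    ((tableau_isTableau mu).dominance g1 h1 k) ((tableau_isTableau lam).dominance g2 h2 k)) h

/-- The scalar `k` with `c² = k c` for the Young symmetrizer `c` of a partition. -/
def scalarOf : ℂ := youngScalar (fun k => (tableau lam k).1) (fun k => (tableau lam k).2)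

theorem scalarOf_ne_zero : scalarOf lam ≠ 0 := youngScalar_ne_zero (tableau_isTableau lam)

theorem scalarOf_mul_chi (σ : Equiv.Perm (Fin n)) :
    scalarOf lam * chi lam σ = ∑ g, (youngOf lam).coeff (g⁻¹ * σ⁻¹ * g) :=
  youngScalar_mul_trace (tableau_isTableau lam) σ

theorem chi_conj (σ τ : Equiv.Perm (Fin n)) : chi lam (τ * σ * τ⁻¹) = chi lam σ := by
  refine mul_left_cancel₀ (scalarOf_ne_zero lam) ?_
  rw [scalarOf_mul_chi, scalarOf_mul_chi, ← Equiv.sum_comp (Equiv.mulLeft τ)]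
  refine Finset.sum_congr rfl fun g _ => ?_
  simp [mul_assoc]

theorem chi_eq_of_isConj {σ τ : Equiv.Perm (Fin n)} (h : IsConj σ τ) : chi lam σ = chi lam τ := by
  obtain ⟨c, rfl⟩ := isConj_iff.1 h
  rw [chi_conj]

/-- A permutation and its inverse have the same cycle type, so orthogonality needs no inverse or
conjugate. -/
theorem chi_inv (σ : Equiv.Perm (Fin n)) : chi lam σ⁻¹ = chi lam σ :=
  chi_eq_of_isConj lam (Equiv.Perm.isConj_iff_cycleType_eq.2 (Equiv.Perm.cycleType_inv σ))

theorem star_youngOf_coeff (g : Equiv.Perm (Fin n)) :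
    (starRingEnd ℂ) ((youngOf lam).coeff g) = (youngOf lam).coeff g := by
  rw [youngOf, young, coeff_mul_eq_sum, map_sum]
  refine Finset.sum_congr rfl fun h _ => ?_
  rw [map_mul, coeff_symmetrizer, coeff_antisymmetrizer]
  congr 1
  · split_ifs <;> simp
  · split_ifs <;> simp

theorem star_chi (σ : Equiv.Perm (Fin n)) : (starRingEnd ℂ) (chi lam σ) = chi lam σ := by
  have hk : (starRingEnd ℂ) (scalarOf lam) = scalarOf lam := by
    change (starRingEnd ℂ) ((youngOf lam * youngOf lam).coeff 1) =
      (youngOf lam * youngOf lam).coeff 1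
    rw [coeff_mul_eq_sum, map_sum]
    simp only [map_mul, star_youngOf_coeff]
  refine mul_left_cancel₀ (scalarOf_ne_zero lam) ?_
  conv_lhs => rw [← hk, ← map_mul, scalarOf_mul_chi, map_sum]
  rw [scalarOf_mul_chi]
  simp only [star_youngOf_coeff]

/-- The orthonormality of the irreducible characters of the symmetric group. -/
theorem sum_chi_mul_chi (lam mu : n.Partition) :
    ∑ σ, chi lam σ * chi mu σ = if lam = mu then (n.factorial : ℂ) else 0 := by
  refine mul_left_cancel₀ (mul_ne_zero (scalarOf_ne_zero lam) (scalarOf_ne_zero mu)) ?_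
  have h := sum_coeff_conj_mul (youngOf lam) (youngOf mu)
  have e : ∀ σ : Equiv.Perm (Fin n), (∑ g, (youngOf lam).coeff (g⁻¹ * σ⁻¹ * g)) *
      (∑ h, (youngOf mu).coeff (h⁻¹ * σ * h)) =
      scalarOf lam * scalarOf mu * (chi lam σ * chi mu σ) := by
    intro σ
    have := scalarOf_mul_chi mu σ⁻¹
    rw [inv_inv, chi_inv] at this
    rw [← this, ← scalarOf_mul_chi]; ring
  rw [Finset.mul_sum, ← Finset.sum_congr rfl fun σ _ => e σ, h]
  split_ifs with hlm
  · subst hlm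
    have := sum_young_coeff (tableau_isTableau lam)
    change ∑ a, (youngOf lam * MonoidAlgebra.of ℂ _ a * youngOf lam).coeff a =
      scalarOf lam ^ 2 at this
    rw [this]; ring
  · simp [youngOf_mul_mul_youngOf hlm]

end

section

open MvPolynomial

/-! ### Orthonormality of the Schur functions in the squared variables -/

theorem wt_mapDomain_two_mul (m : ℕ+ →₀ ℕ) :
    wt (m.mapDomain fun r => 2 * r) = (zee (expParts m) : ℂ) := by
  have h : (zee (expParts m) : ℂ) = wt m * 2 ^ Multiset.card (expParts m) := by
    rw [← zee_expParts]; field_simp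
  have h2 : (Multiset.card (expParts m)) = m.sum fun _ e => e := by
    rw [expParts_eq, Multiset.card_map, Finsupp.card_toMultiset]; rfl
  rw [h, h2, wt, Finsupp.prod, Finsupp.mapDomain_support_of_injective
    (mul_right_injective (2 : ℕ+)), Finset.prod_image (fun _ _ _ _ h => mul_right_injective _ h),
    wt, Finsupp.prod, Finsupp.sum, ← Finset.prod_pow_eq_pow_sum, ← Finset.prod_mul_distrib]
  refine Finset.prod_congr rfl fun k _ => ?_
  rw [Finsupp.mapDomain_apply (mul_right_injective (2 : ℕ+))]
  simp [mul_pow]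
  field_simp

theorem bil_sqVars_powerSum (ρ σ : Multiset ℕ) (hρ : ∀ i ∈ ρ, 0 < i) (hσ : ∀ i ∈ σ, 0 < i) :
    bil (sqVars (powerSum ρ)) (sqVars (powerSum σ)) = if ρ = σ then (zee ρ : ℂ) else 0 := by
  rw [powerSum_eq, powerSum_eq, sqVars, rename_monomial, rename_monomial, bil_monomial,
    wt_mapDomain_two_mul, expParts_toExp _ hρ]
  by_cases h : ρ = σ
  · simp [h]
  · rw [if_neg h, if_neg]
    intro h'
    have := Finsupp.mapDomain_injective (mul_right_injective (2 : ℕ+)) h'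
    exact h (by rw [← expParts_toExp _ hρ, this, expParts_toExp _ hσ])

/-- `cycleType` omits fixed points while `partition` records them as parts `1`; these account for
the factorial of the number of fixed points. -/
theorem zee_partition {n : ℕ} (σ : Equiv.Perm (Fin n)) : zee σ.partition.parts =
    (n - σ.cycleType.sum).factorial * σ.cycleType.prod *
      ∏ i ∈ σ.cycleType.toFinset, (σ.cycleType.count i).factorial := by
  have h1 : 1 ∉ σ.cycleType := fun h => by simpa using Equiv.Perm.two_le_of_mem_cycleType h
  rw [zee, Equiv.Perm.parts_partition, ← Equiv.Perm.sum_cycleType, Fintype.card_fin]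
  set k := n - σ.cycleType.sum
  have h2 : (σ.cycleType + Multiset.replicate k 1).toFinset ⊆ insert 1 σ.cycleType.toFinset := by
    intro i hi
    simp only [Multiset.mem_toFinset, Multiset.mem_add] at hi
    rcases hi with hi | hi
    · simp [hi]
    · simp [Multiset.eq_of_mem_replicate hi]
  rw [Finset.prod_subset h2, Finset.prod_insert (by simpa using h1)]
  · have h3 : ∏ i ∈ σ.cycleType.toFinset,
        ((σ.cycleType + Multiset.replicate k 1).count i).factorial =
        ∏ i ∈ σ.cycleType.toFinset, (σ.cycleType.count i).factorial := by
      refine Finset.prod_congr rfl fun i hi => ?_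
      have : i ≠ 1 := by rintro rfl; exact h1 (by simpa using hi)
      rw [Multiset.count_add, Multiset.count_replicate, if_neg this.symm, add_zero]
    rw [h3, Multiset.count_add, Multiset.count_replicate, if_pos rfl,
      Multiset.count_eq_zero_of_notMem h1]
    simp
    ring
  · intro i _ hi
    rw [Multiset.mem_toFinset] at hi
    rw [Multiset.count_eq_zero_of_notMem hi, Nat.factorial_zero]

theorem card_isConj_mul_zee {n : ℕ} (σ : Equiv.Perm (Fin n)) :
    Finset.card {τ : Equiv.Perm (Fin n) | τ.partition.parts = σ.partition.parts} *
      zee σ.partition.parts = n.factorial := by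
  have h := Equiv.Perm.card_of_cycleType_mul_eq (Fin n) σ.cycleType
  rw [Fintype.card_fin, if_pos ⟨by
    rw [Equiv.Perm.sum_cycleType]; simpa using Finset.card_le_univ σ.support,
    fun a ha => Equiv.Perm.two_le_of_mem_cycleType ha⟩] at h
  rw [zee_partition, ← h]
  congr 2
  ext τ
  simp only [Finset.mem_filter, Finset.mem_univ, true_and]
  rw [← Equiv.Perm.isConj_iff_cycleType_eq, Equiv.Perm.partition_eq_of_isConj,
    Nat.Partition.ext_iff]

theorem partition_parts_sum {n : ℕ} (σ : Equiv.Perm (Fin n)) : σ.partition.parts.sum = n := by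
  rw [σ.partition.parts_sum, Fintype.card_fin]

theorem bil_sqVars_schurS (lam mu : Ptn) :
    bil (sqVars (schurS lam)) (sqVars (schurS mu)) = if lam = mu then 1 else 0 := by
  obtain ⟨n, lam⟩ := lam
  obtain ⟨n', mu⟩ := mu
  have key : bil (sqVars (schurS ⟨n, lam⟩)) (sqVars (schurS ⟨n', mu⟩)) =
      (n.factorial : ℂ)⁻¹ * ((n'.factorial : ℂ)⁻¹ * ∑ σ : Equiv.Perm (Fin n),
        ∑ τ : Equiv.Perm (Fin n'), chi lam σ * (chi mu τ *
          if σ.partition.parts = τ.partition.parts then (zee σ.partition.parts : ℂ) else 0)) := by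
    simp only [schurS, map_smul, map_sum, LinearMap.smul_apply, LinearMap.sum_apply, smul_eq_mul]
    rw [mul_left_comm, Finset.sum_comm]
    refine congrArg₂ _ rfl ?_
    rw [Finset.mul_sum]
    refine Finset.sum_congr rfl fun τ _ => ?_
    rw [mul_left_comm, Finset.mul_sum]
    refine congrArg₂ _ rfl (Finset.sum_congr rfl fun σ _ => ?_)
    rw [bil_sqVars_powerSum _ _ (fun i hi => σ.partition.parts_pos hi)
      (fun i hi => τ.partition.parts_pos hi)]
    ring
  rw [key]
  by_cases hn : n = n'
  · subst hn
    -- Only `τ` in the class of `σ` contribute, and the class has `n!/z_ρ` elements, so the weight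
    -- `z_ρ` turns the inner sum into `n!` times one term.
    have e : ∀ σ : Equiv.Perm (Fin n), ∑ τ : Equiv.Perm (Fin n), chi lam σ * (chi mu τ *
          if σ.partition.parts = τ.partition.parts then (zee σ.partition.parts : ℂ) else 0) =
        (n.factorial : ℂ) * (chi lam σ * chi mu σ) := by
      intro σ
      have e1 : ∀ τ : Equiv.Perm (Fin n), chi lam σ * (chi mu τ *
          if σ.partition.parts = τ.partition.parts then (zee σ.partition.parts : ℂ) else 0) =
          if τ.partition.parts = σ.partition.parts then
            chi lam σ * chi mu σ * (zee σ.partition.parts : ℂ) else 0 := by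
        intro τ
        by_cases h : τ.partition.parts = σ.partition.parts
        · rw [if_pos h.symm, if_pos h, chi_eq_of_isConj mu
            (Equiv.Perm.partition_eq_of_isConj.2 (Nat.Partition.ext h))]
          ring
        · rw [if_neg (Ne.symm h), if_neg h]; ring
      rw [Finset.sum_congr rfl fun τ _ => e1 τ, ← Finset.sum_filter, Finset.sum_const,
        nsmul_eq_mul, ← card_isConj_mul_zee σ]
      push_cast
      ring
    rw [Finset.sum_congr rfl fun σ _ => e σ, ← Finset.mul_sum, sum_chi_mul_chi]
    have hf : (n.factorial : ℂ) ≠ 0 := by exact_mod_cast Nat.factorial_ne_zero n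
    by_cases h : lam = mu
    · subst h
      simp only [if_true]
      field_simp
    · rw [if_neg h, if_neg]
      · simp
      · intro h'; exact h (by simpa using h')
  · rw [if_neg (fun h => hn (congrArg Sigma.fst h)), Finset.sum_eq_zero]
    · simp
    · intro σ _
      refine Finset.sum_eq_zero fun τ _ => ?_
      rw [if_neg]
      · simp
      · intro h
        exact hn (by rw [← partition_parts_sum σ, h, partition_parts_sum])

theorem conj_schurS (lam : Ptn) : conj (schurS lam) = schurS lam := by
  rw [schurS, conj_smul, map_sum]
  congr 1
  · simp
  · refine Finset.sum_congr rfl fun σ _ => ?_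
    rw [conj_smul, star_chi, powerSum_eq, conj, map_monomial, map_one]

/-! ### Bases of homogeneous symmetric functions -/

theorem mem_span_powerSum {f : SymFun} {n : ℕ} (hf : IsHomog f n) :
    f ∈ Submodule.span ℂ (Set.range fun p : n.Partition => powerSum p.parts) := by
  rw [f.as_sum]
  refine Submodule.sum_mem _ fun m hm => ?_
  have hw : (expParts m).sum = n := by
    rw [← weight_eq_sum_expParts]; exact hf (mem_support_iff.1 hm)
  have : monomial m (coeff m f) = coeff m f • powerSum (expParts m) := by
    rw [powerSum_eq, toExp_expParts, smul_monomial, smul_eq_mul, mul_one]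
  rw [this]
  exact Submodule.smul_mem _ _ (Submodule.subset_span
    ⟨⟨expParts m, fun hi => expParts_pos m _ hi, hw⟩, rfl⟩)

/-- In each degree `n` the family has one independent member per partition of `n`, inside a space
spanned by as many power sum products; hence it spans that space. -/
theorem exists_basis_of_linearIndependent (F : Ptn → SymFun) (hF : LinearIndependent ℂ F)
    (hhom : ∀ lam, IsHomog (F lam) lam.1) :
    ∃ b : Module.Basis Ptn ℂ SymFun, ∀ lam, b lam = F lam := by
  have hspan : ∀ n, Submodule.span ℂ (Set.range fun p : n.Partition => F ⟨n, p⟩) =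
      Submodule.span ℂ (Set.range fun p : n.Partition => powerSum p.parts) := by
    intro n
    have hfin : FiniteDimensional ℂ
        (Submodule.span ℂ (Set.range fun p : n.Partition => powerSum p.parts)) :=
      FiniteDimensional.span_of_finite ℂ (Set.finite_range _)
    refine Submodule.eq_of_le_of_finrank_le ?_ ?_
    · rw [Submodule.span_le]
      rintro _ ⟨p, rfl⟩
      exact mem_span_powerSum (hhom ⟨n, p⟩)
    · have hli : LinearIndependent ℂ fun p : n.Partition => F ⟨n, p⟩ :=
        hF.comp (fun p : n.Partition => (⟨n, p⟩ : Ptn)) sigma_mk_injective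
      rw [finrank_span_eq_card hli]
      exact finrank_range_le_card _
  refine ⟨Module.Basis.mk hF ?_, fun lam => Module.Basis.mk_apply _ _ _⟩
  intro f _
  rw [f.as_sum]
  refine Submodule.sum_mem _ fun m _ => ?_
  have h1 := mem_span_powerSum (isWeightedHomogeneous_monomial (fun k : ℕ+ => (k : ℕ)) m
    (coeff m f) rfl)
  rw [← hspan] at h1
  refine Submodule.span_mono ?_ h1
  rintro _ ⟨p, rfl⟩
  exact ⟨_, rfl⟩

/-! ### The compound bases -/

theorem parts_rPart (lam : Ptn) : (rPart lam).2.parts =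
    (lam.2.parts.toFinset.filter fun i => Odd (lam.2.parts.count i)).val := by
  change Multiset.filter (· ≠ 0) _ = _
  rw [Multiset.filter_eq_self]
  intro i hi
  exact (lam.2.parts_pos (Multiset.mem_toFinset.1 (Finset.mem_of_mem_filter i hi))).ne'

theorem parts_dPart (lam : Ptn) : (dPart lam).2.parts =
    ∑ i ∈ lam.2.parts.toFinset, Multiset.replicate (lam.2.parts.count i / 2) i := by
  change Multiset.filter (· ≠ 0) _ = _
  rw [Multiset.filter_eq_self]
  intro i hi
  obtain ⟨j, hj, hij⟩ := Multiset.mem_sum.1 hi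
  rw [Multiset.eq_of_mem_replicate hij]
  exact (lam.2.parts_pos (Multiset.mem_toFinset.1 hj)).ne'

theorem nodup_rPart (lam : Ptn) : (rPart lam).2.parts.Nodup := by
  rw [parts_rPart]; exact Finset.nodup _

theorem count_rPart (lam : Ptn) (i : ℕ) :
    (rPart lam).2.parts.count i = lam.2.parts.count i % 2 := by
  rw [parts_rPart]
  by_cases h : Odd (lam.2.parts.count i)
  · rw [Multiset.count_eq_one_of_mem (Finset.nodup _), Nat.odd_iff.1 h]
    rw [Finset.mem_val, Finset.mem_filter, Multiset.mem_toFinset, ← Multiset.count_pos]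
    exact ⟨h.pos, h⟩
  · rw [Multiset.count_eq_zero_of_notMem, Nat.even_iff.1 (Nat.not_odd_iff_even.1 h)]
    rw [Finset.mem_val, Finset.mem_filter]
    exact fun h' => h h'.2

theorem count_dPart (lam : Ptn) (i : ℕ) :
    (dPart lam).2.parts.count i = lam.2.parts.count i / 2 := by
  rw [parts_dPart, Multiset.count_sum']
  simp only [Multiset.count_replicate]
  rw [Finset.sum_ite_eq']
  split_ifs with h
  · rfl
  · rw [Multiset.mem_toFinset, ← Multiset.count_eq_zero] at h
    simp [h]

theorem eq_of_rPart_of_dPart {lam mu : Ptn} (h1 : rPart lam = rPart mu)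
    (h2 : dPart lam = dPart mu) : lam = mu := by
  refine ptn_ext (Multiset.ext.2 fun i => ?_)
  have e1 := count_rPart lam i
  have e2 := count_dPart lam i
  rw [h1, count_rPart] at e1
  rw [h2, count_dPart] at e2
  omega

/-- Each multiplicity is `m = (m mod 2) + 2 ⌊m/2⌋`. This places `W_λ` and `V_λ` in degree `|λ|`, as
the dimension count requires. -/
theorem degree_rPart_add (lam : Ptn) : (rPart lam).1 + 2 * (dPart lam).1 = lam.1 := by
  have h : ∀ nu : Ptn, (∀ i, nu.2.parts.count i ≤ lam.2.parts.count i) →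
      nu.1 = ∑ i ∈ lam.2.parts.toFinset, nu.2.parts.count i * i := by
    intro nu hnu
    conv_lhs => rw [← nu.2.parts_sum, Finset.sum_multiset_count]
    refine Finset.sum_subset ?_ ?_
    · intro i hi
      rw [Multiset.mem_toFinset, ← Multiset.count_pos] at hi ⊢
      exact hi.trans_le (hnu i)
    · intro i _ hi
      rw [Multiset.mem_toFinset, ← Multiset.count_eq_zero] at hi
      simp [hi]
  rw [h (rPart lam) (fun i => by rw [count_rPart]; exact Nat.mod_le _ _),
    h (dPart lam) (fun i => by rw [count_dPart]; exact Nat.div_le_self _ _)]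
  conv_rhs => rw [h lam fun i => le_rfl]
  rw [Finset.mul_sum, ← Finset.sum_add_distrib]
  refine Finset.sum_congr rfl fun i _ => ?_
  rw [count_rPart, count_dPart, ← mul_assoc, ← add_mul, Nat.mod_add_div]

theorem isHomog_W (lam : Ptn) : IsHomog (W lam) lam.1 := by
  have := (isHomog_schurQ (rPart lam)).mul (isHomog_sqVars (isHomog_schurS (dPart lam)))
  rwa [degree_rPart_add] at this

theorem V_eq_smul_W (lam : Ptn) :
    V lam = ((2 : ℂ) ^ Multiset.card (rPart lam).2.parts)⁻¹ • W lam := by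
  rw [V, W, schurP, smul_mul_assoc]

theorem isHomog_V (lam : Ptn) : IsHomog (V lam) lam.1 := by
  rw [V_eq_smul_W]
  exact (weightedHomogeneousSubmodule ℂ (fun k : ℕ+ => (k : ℕ)) lam.1).smul_mem _ (isHomog_W lam)

theorem bil_W_V (lam mu : Ptn) : bil (W lam) (V mu) = if lam = mu then 1 else 0 := by
  rw [V_eq_smul_W, W, W, map_smul, bil_schurQ_mul _ _ (nodup_rPart lam) (nodup_rPart mu),
    bil_sqVars_schurS]
  by_cases h : lam = mu
  · subst h
    simp
  · rw [if_neg h]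
    split_ifs with h1 h2
    · exact absurd (eq_of_rPart_of_dPart h1 h2) h
    · simp
    · simp

theorem conj_V (lam : Ptn) : conj (V lam) = V lam := by
  rw [V, schurP, map_mul, conj_smul, conj_schurQ, conj_sqVars, conj_schurS]
  simp [map_ofNat]

theorem linearIndependent_of_dual {F G : Ptn → SymFun}
    (h : ∀ lam mu, bil (F lam) (G mu) = if lam = mu then 1 else 0) : LinearIndependent ℂ F := by
  rw [linearIndependent_iff]
  intro l hl
  ext mu
  have := congrArg (fun f => bil f (G mu)) hl
  simpa [Finsupp.linearCombination_apply, Finsupp.sum, LinearMap.sum_apply, h] using this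

end

end CompoundBasis

end

theorem corollary4p2 :
    (∃ w v : Module.Basis CompoundBasis.Ptn ℂ CompoundBasis.SymFun,
      (∀ lam, w lam = CompoundBasis.W lam) ∧ (∀ mu, v mu = CompoundBasis.V mu)) ∧
    ∀ lam mu : CompoundBasis.Ptn,
      CompoundBasis.innerNegOne (CompoundBasis.W lam) (CompoundBasis.V mu) =
        if lam = mu then 1 else 0 := by
  obtain ⟨w, hw⟩ := CompoundBasis.exists_basis_of_linearIndependent _
    (CompoundBasis.linearIndependent_of_dual CompoundBasis.bil_W_V) CompoundBasis.isHomog_W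
  -- Symmetry of `bil` makes `W` dual to `V` as well, so independence of `V` follows from the same
  -- relation.
  obtain ⟨v, hv⟩ := CompoundBasis.exists_basis_of_linearIndependent _
    (CompoundBasis.linearIndependent_of_dual (G := CompoundBasis.W) fun lam mu => by
      rw [CompoundBasis.bil_symm, CompoundBasis.bil_W_V]
      exact if_congr eq_comm rfl rfl) CompoundBasis.isHomog_V
  refine ⟨⟨w, v, hw, hv⟩, fun lam mu => ?_⟩
  rw [CompoundBasis.innerNegOne_eq_bil, CompoundBasis.conj_V, CompoundBasis.bil_W_V]
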